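/- Let $k$ be a field with $\operatorname{char}(k)\neq 2$ and let $n\ge 1$. Let $E(n)$ be the Hopf algebra over $k$ generated by $c,x_1,\dots,x_n$ with relations $$c^2=1,\qquad cx_i+x_ic=0,\qquad x_ix_j+x_jx_i=0,\qquad x_i^2=0,$$ coproduct $\Delta(c)=c\otimes c$, $\Delta(x_i)=1\otimes x_i+x_i\otimes c$, counit $\varepsilon(c)=1$, $\varepsilon(x_i)=0$, and antipode $S(c)=c$, $S(x_i)=cx_i$. For $P\subseteq\{1,\dots,n\}$ let $x_P$ be the product of the $x_j$, $j\in P$, in increasing order; the elements $x_P$, $cx_P$ form a basis of $E(n)$, with dual basis $(x_P)^*,(cx_P)^*$. For $A=(a_{ij})\in M_n(k)$ put $$r_A=\sum_P(-1)^{\frac{|P|(|P|-1)}2}\sum_{F,\ |F|=|P|}\ \sum_{\eta\in S_{|P|}}\operatorname{sign}(\eta)\,a_{p_1,f_{\eta(1)}}\cdots a_{p_s,f_{\eta(s)}}\Bigl((x_P)^*\otimes(x_F)^*+(cx_P)^*\otimes(x_F)^*+(-1)^{|P|}(x_P)^*\otimes(cx_F)^*-(-1)^{|P|}(cx_P)^*\otimes(cx_F)^*\Bigr),$$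 where $P=\{p_1<\dots<p_s\}$ and $F=\{f_1<\dots<f_s\}$ run over the subsets of $\{1,\dots,n\}$. For a Hopf algebra $H$, a universal $r$-form is a convolution invertible linear form $r$ on $H\otimes H$ with $r(ab\otimes h)=\sum r(a\otimes h_{(1)})r(b\otimes h_{(2)})$, $r(h\otimes ab)=\sum r(h_{(1)}\otimes b)r(h_{(2)}\otimes a)$, $r(1\otimes h)=\varepsilon(h)=r(h\otimes1)$ and $\sum r(a_{(1)}\otimes b_{(1)})\,a_{(2)}b_{(2)}=\sum b_{(1)}a_{(1)}\,r(a_{(2)}\otimes b_{(2)})$. A finite-dimensional right $H^{op}$-comodule algebra $B$, with coaction $b\mapsto\sum b_{(0)}\otimes b_{(1)}$, is called $(H,r)$-Azumaya if the comodule algebra maps $$F\colon B\#\overline B\to \operatorname{End}(B),\quad F(a\#\bar b)(d)=\sum a\,d_{(0)}b_{(0)}\,r(d_{(1)}\otimes b_{(1)}),$$ $$G\colon \overline B\# B\to \operatorname{End}(B)^{op},\quad G(\bar a\# b)(d)=\sum r(a_{(1)}\otimes d_{(1)})\,a_{(0)}d_{(0)}b$$ are isomorphisms, i.e. bijective. Here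 $\overline B$ is the comodule $B$ with product $a\circ b=\sum b_{(0)}a_{(0)}\,r(b_{(1)}\otimes a_{(1)})$, and $B\#C$ is $B\otimes C$ with product $(a\#b)(a'\#b')=\sum aa'_{(0)}\#b_{(0)}b'\,r(a'_{(1)}\otimes b_{(1)})$. Then, for every $A\in M_n(k)$, the form $r_A$ is a universal $r$-form on $E(n)$, and the comodule algebra $E(n)^{op}$ (the opposite algebra of $E(n)$, with coaction $\Delta$) is $(E(n),r_A)$-Azumaya if and only if $\det(A)\neq0$. -/

import Mathlib

open scoped TensorProduct

noncomputable section

/-! ### Comodule algebras and Azumaya algebras over a dual quasitriangular Hopf algebra -/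

section Azumaya

variable (k : Type*) [Field k]

/-- For a linear form `r` on `H ⊗ H`, the linear map
`(A ⊗ H) ⊗ (A ⊗ H) → A`, `(a ⊗ h) ⊗ (b ⊗ g) ↦ r(h ⊗ g) a b`. -/
def pairMul {k : Type*} [Field k] {H A : Type*} [Ring H] [Algebra k H] [Ring A] [Algebra k A]
    (r : H ⊗[k] H →ₗ[k] k) : (A ⊗[k] H) ⊗[k] (A ⊗[k] H) →ₗ[k] A :=
  (TensorProduct.rid k A).toLinearMap ∘ₗ TensorProduct.map (LinearMap.mul' k A) r ∘ₗ
    (TensorProduct.tensorTensorTensorComm k A H A H).toLinearMap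

theorem pairMul_tmul {k : Type*} [Field k] {H A : Type*} [Ring H] [Algebra k H] [Ring A]
    [Algebra k A] (r : H ⊗[k] H →ₗ[k] k) (a b : A) (h g : H) :
    pairMul r ((a ⊗ₜ[k] h) ⊗ₜ[k] (b ⊗ₜ[k] g)) = r (h ⊗ₜ[k] g) • (a * b) := by
  simp [pairMul]

/-- Universal `r`-forms on a Hopf algebra `H`: convolution invertible linear forms `r` on `H ⊗ H`
with
* `r(ab ⊗ h) = ∑ r(a ⊗ h₁) r(b ⊗ h₂)` and `r(1 ⊗ h) = ε(h)`,
* `r(h ⊗ ab) = ∑ r(h₁ ⊗ b) r(h₂ ⊗ a)` and `r(h ⊗ 1) = ε(h)`,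
* `∑ r(a₁ ⊗ b₁) a₂ b₂ = ∑ b₁ a₁ r(a₂ ⊗ b₂)`. -/
structure IsUniversalRForm {H : Type*} [Ring H] [HopfAlgebra k H]
    (r : H ⊗[k] H →ₗ[k] k) : Prop where
  mul_left : ∀ a b h : H, r ((a * b) ⊗ₜ[k] h) =
    LinearMap.mul' k k (TensorProduct.map (r ∘ₗ TensorProduct.mk k H H a)
      (r ∘ₗ TensorProduct.mk k H H b) (Coalgebra.comul h))
  one_left : ∀ h : H, r (1 ⊗ₜ[k] h) = Coalgebra.counit (R := k) h
  mul_right : ∀ h a b : H, r (h ⊗ₜ[k] (a * b)) =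
    LinearMap.mul' k k (TensorProduct.map (r ∘ₗ (TensorProduct.mk k H H).flip b)
      (r ∘ₗ (TensorProduct.mk k H H).flip a) (Coalgebra.comul h))
  one_right : ∀ h : H, r (h ⊗ₜ[k] 1) = Coalgebra.counit (R := k) h
  /- `Coalgebra.comul (a ⊗ b) = ∑ (a₁ ⊗ b₁) ⊗ (a₂ ⊗ b₂)` in the tensor product coalgebra. -/
  comm : ∀ a b : H,
    TensorProduct.lid k H (TensorProduct.map r (LinearMap.mul' k H)
      (Coalgebra.comul (R := k) (a ⊗ₜ[k] b))) =
    TensorProduct.rid k H (TensorProduct.map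
      (LinearMap.mul' k H ∘ₗ (TensorProduct.comm k H H).toLinearMap) r
      (Coalgebra.comul (R := k) (a ⊗ₜ[k] b)))
  conv_inv : ∃ s : H ⊗[k] H →ₗ[k] k,
    (LinearMap.mul' k k ∘ₗ TensorProduct.map r s ∘ₗ Coalgebra.comul =
      Coalgebra.counit (R := k) (A := H ⊗[k] H)) ∧
    (LinearMap.mul' k k ∘ₗ TensorProduct.map s r ∘ₗ Coalgebra.comul =
      Coalgebra.counit (R := k) (A := H ⊗[k] H))

/-- An `Hᵒᵖ`-comodule algebra structure on a `k`-algebra `A`: a right `H`-comodule structure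
`ρ : A → A ⊗ H` such that `ρ(1) = 1 ⊗ 1` and `ρ(ab) = ∑ a₀ b₀ ⊗ b₁ a₁`. These are the algebras in
the monoidal category of right `H`-comodules, where `M ⊗ N` carries the coaction
`m ⊗ n ↦ ∑ m₀ ⊗ n₀ ⊗ n₁ m₁`. -/
structure OpComoduleAlgebra (H : Type*) [Ring H] [HopfAlgebra k H]
    (A : Type*) [Ring A] [Algebra k A] where
  coact : A →ₗ[k] A ⊗[k] H
  coassoc : ∀ a : A, TensorProduct.assoc k A H H (coact.rTensor H (coact a)) =
    (Coalgebra.comul (R := k) (A := H)).lTensor A (coact a)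
  counit_coact : ∀ a : A, TensorProduct.rid k A
    ((Coalgebra.counit (R := k) (A := H)).lTensor A (coact a)) = a
  coact_one : coact 1 = 1 ⊗ₜ[k] 1
  coact_mul : ∀ a b : A, coact (a * b) =
    TensorProduct.map (LinearMap.mul' k A)
      (LinearMap.mul' k H ∘ₗ (TensorProduct.comm k H H).toLinearMap)
      (TensorProduct.tensorTensorTensorComm k A H A H (coact a ⊗ₜ[k] coact b))

variable {k}

/-- The canonical map `F : A # Ā → End(A)`, `F(a # b)(c) = ∑ a c₀ b₀ r(c₁ ⊗ b₁)`. -/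
def azumayaF {H : Type*} [Ring H] [HopfAlgebra k H] {A : Type*} [Ring A] [Algebra k A]
    (r : H ⊗[k] H →ₗ[k] k) (C : OpComoduleAlgebra k H A) :
    A ⊗[k] A →ₗ[k] Module.End k A :=
  TensorProduct.lift (LinearMap.mk₂ k
    (fun a b => LinearMap.mulLeft k a ∘ₗ pairMul r ∘ₗ
      (TensorProduct.mk k (A ⊗[k] H) (A ⊗[k] H)).flip (C.coact b) ∘ₗ C.coact)
    (by intros; ext; simp [add_mul]) (by intros; ext; simp)
    (by intros; ext; simp [mul_add]) (by intros; ext; simp))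

theorem azumayaF_apply {H : Type*} [Ring H] [HopfAlgebra k H] {A : Type*} [Ring A] [Algebra k A]
    (r : H ⊗[k] H →ₗ[k] k) (C : OpComoduleAlgebra k H A) (a b c : A) :
    azumayaF r C (a ⊗ₜ[k] b) c = a * pairMul r (C.coact c ⊗ₜ[k] C.coact b) := by
  simp [azumayaF]

/-- The canonical map `G : Ā # A → End(A)ᵒᵖ`, `G(a # b)(c) = ∑ r(a₁ ⊗ c₁) a₀ c₀ b`
(`End(A)ᵒᵖ` and `End(A)` have the same underlying space). -/
def azumayaG {H : Type*} [Ring H] [HopfAlgebra k H] {A : Type*} [Ring A] [Algebra k A]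
    (r : H ⊗[k] H →ₗ[k] k) (C : OpComoduleAlgebra k H A) :
    A ⊗[k] A →ₗ[k] Module.End k A :=
  TensorProduct.lift (LinearMap.mk₂ k
    (fun a b => LinearMap.mulRight k b ∘ₗ pairMul r ∘ₗ
      (TensorProduct.mk k (A ⊗[k] H) (A ⊗[k] H)) (C.coact a) ∘ₗ C.coact)
    (by intros; ext; simp [add_mul])
    (by intros; ext; simp)
    (by intros; ext; simp [mul_add]) (by intros; ext; simp))

theorem azumayaG_apply {H : Type*} [Ring H] [HopfAlgebra k H] {A : Type*} [Ring A] [Algebra k A]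
    (r : H ⊗[k] H →ₗ[k] k) (C : OpComoduleAlgebra k H A) (a b c : A) :
    azumayaG r C (a ⊗ₜ[k] b) c = pairMul r (C.coact a ⊗ₜ[k] C.coact c) * b := by
  simp [azumayaG]

/-- A (finite-dimensional) `Hᵒᵖ`-comodule algebra `A` is `(H, r)`-Azumaya if the comodule algebra
maps `F : A # Ā → End(A)` and `G : Ā # A → End(A)ᵒᵖ` are isomorphisms, that is, bijective. (For a
universal `r`-form `r`, the maps `F` and `G` are always comodule algebra maps, and the inverse of a
bijective comodule algebra map is again one.) -/
def IsHAzumaya {H : Type*} [Ring H] [HopfAlgebra k H] {A : Type*} [Ring A] [Algebra k A]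
    (r : H ⊗[k] H →ₗ[k] k) (C : OpComoduleAlgebra k H A) : Prop :=
  Module.Finite k A ∧ Function.Bijective (azumayaF r C) ∧ Function.Bijective (azumayaG r C)

/-- The opposite algebra `Hᵒᵖ`, with the coproduct `h ↦ ∑ h₁ ⊗ h₂` of `H` as coaction, as an
`Hᵒᵖ`-comodule algebra. -/
def opComoduleAlgebra (k : Type*) [Field k] (H : Type*) [Ring H] [HopfAlgebra k H] :
    OpComoduleAlgebra k H Hᵐᵒᵖ where
  coact := (MulOpposite.opLinearEquiv k).toLinearMap.rTensor H ∘ₗ Coalgebra.comul ∘ₗ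
    (MulOpposite.opLinearEquiv k).symm.toLinearMap
  coassoc a := by
    have h := Coalgebra.coassoc_apply (R := k) a.unop
    have h1 : ∀ (t : H ⊗[k] H) (v : H), TensorProduct.assoc k Hᵐᵒᵖ H H
        ((MulOpposite.opLinearEquiv k).toLinearMap.rTensor H t ⊗ₜ[k] v) =
        (MulOpposite.opLinearEquiv k).toLinearMap.rTensor (H ⊗[k] H)
          (TensorProduct.assoc k H H H (t ⊗ₜ[k] v)) := by
      intro t v
      induction t using TensorProduct.induction_on with
      | zero => simp
      | add s t hs ht => simp only [map_add, TensorProduct.add_tmul, hs, ht]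
      | tmul p q => simp
    have h2 : ∀ t : H ⊗[k] H, TensorProduct.assoc k Hᵐᵒᵖ H H
        (((MulOpposite.opLinearEquiv k).toLinearMap.rTensor H ∘ₗ Coalgebra.comul ∘ₗ
          (MulOpposite.opLinearEquiv k).symm.toLinearMap).rTensor H
            ((MulOpposite.opLinearEquiv k).toLinearMap.rTensor H t)) =
        (MulOpposite.opLinearEquiv k).toLinearMap.rTensor (H ⊗[k] H)
          (TensorProduct.assoc k H H H
            ((Coalgebra.comul (R := k) (A := H)).rTensor H t)) := by
      intro t
      induction t using TensorProduct.induction_on with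
      | zero => simp
      | add s t hs ht => simp only [map_add, hs, ht]
      | tmul p q => simpa using h1 _ q
    have h3 : ∀ t : H ⊗[k] H, (Coalgebra.comul (R := k) (A := H)).lTensor Hᵐᵒᵖ
        ((MulOpposite.opLinearEquiv k).toLinearMap.rTensor H t) =
        (MulOpposite.opLinearEquiv k).toLinearMap.rTensor (H ⊗[k] H)
          ((Coalgebra.comul (R := k) (A := H)).lTensor H t) := by
      intro t
      induction t using TensorProduct.induction_on with
      | zero => simp
      | add s t hs ht => simp only [map_add, hs, ht]
      | tmul p q => simp
    exact (h2 _).trans ((congrArg _ h).trans (h3 _).symm)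
  counit_coact a := by
    have h := Coalgebra.lTensor_counit_comul (R := k) a.unop
    have h1 : ∀ t : H ⊗[k] H, TensorProduct.rid k Hᵐᵒᵖ
        ((Coalgebra.counit (R := k) (A := H)).lTensor Hᵐᵒᵖ
          ((MulOpposite.opLinearEquiv k).toLinearMap.rTensor H t)) =
        MulOpposite.op (TensorProduct.rid k H
          ((Coalgebra.counit (R := k) (A := H)).lTensor H t)) := by
      intro t
      induction t using TensorProduct.induction_on with
      | zero => simp
      | add s t hs ht => simp only [map_add, hs, ht, MulOpposite.op_add]
      | tmul p q => simp
    refine (h1 _).trans ?_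
    change MulOpposite.op (TensorProduct.rid k H
      ((Coalgebra.counit (R := k) (A := H)).lTensor H (Coalgebra.comul a.unop))) = a
    rw [h]
    simp
  coact_one := by
    simp [Algebra.TensorProduct.one_def]
  coact_mul a b := by
    have h1 : ∀ s t : H ⊗[k] H, (MulOpposite.opLinearEquiv k).toLinearMap.rTensor H (t * s) =
        TensorProduct.map (LinearMap.mul' k Hᵐᵒᵖ)
          (LinearMap.mul' k H ∘ₗ (TensorProduct.comm k H H).toLinearMap)
          (TensorProduct.tensorTensorTensorComm k Hᵐᵒᵖ H Hᵐᵒᵖ H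
            ((MulOpposite.opLinearEquiv k).toLinearMap.rTensor H s ⊗ₜ[k]
              (MulOpposite.opLinearEquiv k).toLinearMap.rTensor H t)) := by
      intro s t
      induction s using TensorProduct.induction_on with
      | zero => simp
      | add s s' hs hs' => simp only [map_add, mul_add, TensorProduct.add_tmul, hs, hs']
      | tmul p q =>
        induction t using TensorProduct.induction_on with
        | zero => simp
        | add t t' ht ht' => simp only [map_add, add_mul, TensorProduct.tmul_add, ht, ht']
        | tmul u v => simp
    simpa using h1 (Coalgebra.comul a.unop) (Coalgebra.comul b.unop)

end Azumaya

/-! ### The Hopf algebra `E(n)` -/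

/-- The generators `c`, `x₁, …, xₙ`. -/
inductive EGen (n : ℕ) : Type
  | c : EGen n
  | x : Fin n → EGen n

/-- The relations `c² = 1`, `c xᵢ + xᵢ c = 0`, `xᵢ xⱼ + xⱼ xᵢ = 0`, `xᵢ² = 0`. -/
inductive ERel (k : Type*) [Field k] (n : ℕ) :
    FreeAlgebra k (EGen n) → FreeAlgebra k (EGen n) → Prop
  | c_sq : ERel k n (FreeAlgebra.ι k EGen.c * FreeAlgebra.ι k EGen.c) 1
  | c_x (i : Fin n) : ERel k n (FreeAlgebra.ι k EGen.c * FreeAlgebra.ι k (EGen.x i) +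
      FreeAlgebra.ι k (EGen.x i) * FreeAlgebra.ι k EGen.c) 0
  | x_x (i j : Fin n) : ERel k n (FreeAlgebra.ι k (EGen.x i) * FreeAlgebra.ι k (EGen.x j) +
      FreeAlgebra.ι k (EGen.x j) * FreeAlgebra.ι k (EGen.x i)) 0
  | x_sq (i : Fin n) : ERel k n (FreeAlgebra.ι k (EGen.x i) * FreeAlgebra.ι k (EGen.x i)) 0

/-- The `k`-algebra `E(n)`. -/
def EHopf (k : Type*) [Field k] (n : ℕ) : Type _ := RingQuot (ERel k n)

namespace EHopf

variable (k : Type*) [Field k] {n : ℕ}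

instance : Ring (EHopf k n) := inferInstanceAs (Ring (RingQuot (ERel k n)))

instance : Algebra k (EHopf k n) := inferInstanceAs (Algebra k (RingQuot (ERel k n)))

/-- The image of a generator in `E(n)`. -/
def gen (g : EGen n) : EHopf k n := RingQuot.mkAlgHom k (ERel k n) (FreeAlgebra.ι k g)

/-- The generator `c`. -/
def c : EHopf k n := gen k EGen.c

/-- The generator `xᵢ`. -/
def x (i : Fin n) : EHopf k n := gen k (EGen.x i)

theorem c_mul_c : c k * c k = (1 : EHopf k n) := by
  have h := RingQuot.mkAlgHom_rel k (ERel.c_sq (k := k) (n := n))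
  simp only [map_mul, map_one] at h
  exact h

theorem c_x_add (i : Fin n) : c k * x k i + x k i * c k = 0 := by
  have h := RingQuot.mkAlgHom_rel k (ERel.c_x (k := k) (n := n) i)
  simp only [map_mul, map_add, map_zero] at h
  exact h

theorem x_x_add (i j : Fin n) : x k i * x k j + x k j * x k i = 0 := by
  have h := RingQuot.mkAlgHom_rel k (ERel.x_x (k := k) (n := n) i j)
  simp only [map_mul, map_add, map_zero] at h
  exact h

theorem x_mul_x (i : Fin n) : x k i * x k i = 0 := by
  have h := RingQuot.mkAlgHom_rel k (ERel.x_sq (k := k) (n := n) i)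
  simp only [map_mul, map_zero] at h
  exact h

theorem x_mul_c (i : Fin n) : x k i * c k = -(c k * x k i) := by
  rw [eq_neg_iff_add_eq_zero, add_comm, c_x_add]

theorem x_mul_x_swap (i j : Fin n) : x k i * x k j = -(x k j * x k i) := by
  rw [eq_neg_iff_add_eq_zero, x_x_add]

variable {k}

/-- The universal property of `E(n)`: algebra maps out of it are given by the images of the
generators, subject to the relations. -/
def lift {B : Type*} [Ring B] [Algebra k B] (C : B) (X : Fin n → B) (h1 : C * C = 1)
    (h2 : ∀ i, C * X i + X i * C = 0) (h3 : ∀ i j, X i * X j + X j * X i = 0)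
    (h4 : ∀ i, X i * X i = 0) : EHopf k n →ₐ[k] B :=
  RingQuot.liftAlgHom k (s := ERel k n)
    ⟨FreeAlgebra.lift k (fun g => match g with | EGen.c => C | EGen.x i => X i), by
      intro a b h
      cases h <;> simp [*]⟩

section

variable {B : Type*} [Ring B] [Algebra k B] {C : B} {X : Fin n → B} {h1 : C * C = 1}
    {h2 : ∀ i, C * X i + X i * C = 0} {h3 : ∀ i j, X i * X j + X j * X i = 0}
    {h4 : ∀ i, X i * X i = 0}

@[simp] theorem lift_c : lift (k := k) C X h1 h2 h3 h4 (c k) = C :=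
  (RingQuot.liftAlgHom_mkAlgHom_apply k _ _ _).trans (FreeAlgebra.lift_ι_apply _ _)

@[simp] theorem lift_x (i : Fin n) : lift (k := k) C X h1 h2 h3 h4 (x k i) = X i :=
  (RingQuot.liftAlgHom_mkAlgHom_apply k _ _ _).trans (FreeAlgebra.lift_ι_apply _ _)

end

theorem algHom_ext {B : Type*} [Semiring B] [Algebra k B] {f g : EHopf k n →ₐ[k] B}
    (hc : f (c k) = g (c k)) (hx : ∀ i, f (x k i) = g (x k i)) : f = g := by
  refine RingQuot.ringQuot_ext' k _ _ (FreeAlgebra.hom_ext (funext fun a => ?_))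
  cases a with
  | c => exact hc
  | x i => exact hx i

theorem induction {p : EHopf k n → Prop} (hs : ∀ a : k, p (algebraMap k _ a)) (hc : p (c k))
    (hx : ∀ i, p (x k i)) (hm : ∀ a b, p a → p b → p (a * b))
    (ha : ∀ a b, p a → p b → p (a + b)) (a : EHopf k n) : p a := by
  obtain ⟨a, rfl⟩ := RingQuot.mkAlgHom_surjective k (ERel k n) a
  induction a using FreeAlgebra.induction with
  | grade0 r => exact ((RingQuot.mkAlgHom k (ERel k n)).commutes r).symm ▸ hs r
  | grade1 g => cases g with
    | c => exact hc
    | x i => exact hx i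
  | mul a b h1 h2 => exact (map_mul (RingQuot.mkAlgHom k (ERel k n)) a b).symm ▸ hm _ _ h1 h2
  | add a b h1 h2 => exact (map_add (RingQuot.mkAlgHom k (ERel k n)) a b).symm ▸ ha _ _ h1 h2

variable (k n)

/-- The coproduct: `Δ(c) = c ⊗ c` and `Δ(xᵢ) = 1 ⊗ xᵢ + xᵢ ⊗ c`. -/
def comulHom : EHopf k n →ₐ[k] EHopf k n ⊗[k] EHopf k n :=
  lift (c k ⊗ₜ[k] c k) (fun i => 1 ⊗ₜ[k] x k i + x k i ⊗ₜ[k] c k)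
    (by simp [c_mul_c, Algebra.TensorProduct.one_def])
    (fun i => by
      simp [mul_add, add_mul, c_mul_c, x_mul_c, TensorProduct.tmul_neg, TensorProduct.neg_tmul]
      abel)
    (fun i j => by
      simp only [mul_add, add_mul, Algebra.TensorProduct.tmul_mul_tmul, one_mul, mul_one, c_mul_c,
        x_mul_c]
      rw [x_mul_x_swap k i j]
      simp [TensorProduct.tmul_neg, TensorProduct.neg_tmul]
      abel)
    (fun i => by
      simp [mul_add, add_mul, c_mul_c, x_mul_c, x_mul_x, TensorProduct.tmul_neg])

/-- The counit: `ε(c) = 1` and `ε(xᵢ) = 0`. -/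
def counitHom : EHopf k n →ₐ[k] k :=
  lift 1 (fun _ => 0) (by simp) (by simp) (by simp) (by simp)

/-- The antipode, an algebra map to the opposite algebra: `S(c) = c` and `S(xᵢ) = c xᵢ`. -/
def antipodeHom : EHopf k n →ₐ[k] (EHopf k n)ᵐᵒᵖ :=
  lift (MulOpposite.op (c k)) (fun i => MulOpposite.op (c k * x k i))
    (by rw [← MulOpposite.op_mul, c_mul_c, MulOpposite.op_one])
    (fun i => by
      rw [← MulOpposite.op_mul, ← MulOpposite.op_mul, ← MulOpposite.op_add, mul_assoc, x_mul_c]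
      simp)
    (fun i j => by
      have h : ∀ i j : Fin n, c k * x k i * (c k * x k j) = -(x k i * x k j) := fun i j => by
        rw [mul_assoc, ← mul_assoc (x k i), x_mul_c, neg_mul, mul_neg, mul_assoc, ← mul_assoc,
          c_mul_c, one_mul]
      rw [← MulOpposite.op_mul, ← MulOpposite.op_mul, ← MulOpposite.op_add, h, h, ← neg_add,
        x_x_add]
      simp)
    (fun i => by
      rw [← MulOpposite.op_mul, mul_assoc, ← mul_assoc (x k i), x_mul_c]
      simp [mul_assoc, x_mul_x])

instance : Bialgebra k (EHopf k n) :=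
  Bialgebra.ofAlgHom (comulHom k n) (counitHom k n)
    (algHom_ext (by simp [comulHom]) fun i => by
      simp [comulHom, TensorProduct.tmul_add, TensorProduct.add_tmul,
        Algebra.TensorProduct.one_def, add_assoc])
    (algHom_ext (by simp [comulHom, counitHom]) fun i => by simp [comulHom, counitHom])
    (algHom_ext (by simp [comulHom, counitHom]) fun i => by simp [comulHom, counitHom])

variable {n}

theorem comul_c : Coalgebra.comul (R := k) (c k : EHopf k n) = c k ⊗ₜ[k] c k :=
  lift_c

theorem comul_x (i : Fin n) :
    Coalgebra.comul (R := k) (x k i) = 1 ⊗ₜ[k] x k i + x k i ⊗ₜ[k] c k :=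
  lift_x i

theorem counit_c : Coalgebra.counit (R := k) (c k : EHopf k n) = 1 :=
  lift_c

theorem counit_x (i : Fin n) : Coalgebra.counit (R := k) (x k i) = 0 :=
  lift_x i

variable (n) in
/-- The antipode as a linear map. -/
def antipodeLin : EHopf k n →ₗ[k] EHopf k n :=
  (MulOpposite.opLinearEquiv k).symm.toLinearMap ∘ₗ (antipodeHom k n).toLinearMap

theorem antipodeLin_mul (a b : EHopf k n) :
    antipodeLin k n (a * b) = antipodeLin k n b * antipodeLin k n a := by
  simp [antipodeLin]

theorem antipodeLin_one : antipodeLin k n 1 = 1 := by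
  simp [antipodeLin]

theorem antipodeLin_c : antipodeLin k n (c k) = c k := by
  simp [antipodeLin, antipodeHom]

theorem antipodeLin_x (i : Fin n) : antipodeLin k n (x k i) = c k * x k i := by
  simp [antipodeLin, antipodeHom]

theorem antipode_left (a : EHopf k n) :
    LinearMap.mul' k _ ((antipodeLin k n).rTensor _ (Coalgebra.comul (R := k) a)) =
      algebraMap k _ (Coalgebra.counit (R := k) a) := by
  induction a using EHopf.induction with
  | hs a => simp [Algebra.algebraMap_eq_smul_one, antipodeLin_one, Algebra.TensorProduct.one_def]
  | hc => simp [comul_c, counit_c, antipodeLin_c, c_mul_c]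
  | hx i =>
    simp only [comul_x, counit_x, map_add, LinearMap.rTensor_tmul, LinearMap.mul'_apply,
      antipodeLin_one, antipodeLin_x, one_mul, mul_assoc, x_mul_c]
    rw [mul_neg, ← mul_assoc, c_mul_c]; simp
  | ha a b h1 h2 => simp only [map_add, h1, h2]
  | hm a b h1 h2 =>
    have key : ∀ (s t : EHopf k n ⊗[k] EHopf k n),
        LinearMap.mul' k _ ((antipodeLin k n).rTensor _ (s * t)) =
        LinearMap.mul' k _ (TensorProduct.map (antipodeLin k n)
          (LinearMap.mulLeft k (LinearMap.mul' k _ ((antipodeLin k n).rTensor _ s))) t) := by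
      intro s t
      induction s using TensorProduct.induction_on with
      | zero => simp
      | add s s' hs hs' =>
        have : ∀ u v : EHopf k n, LinearMap.mulLeft k (u + v) = LinearMap.mulLeft k u +
          LinearMap.mulLeft k v := fun u v => by ext; simp [add_mul]
        simp only [add_mul, map_add, hs, hs', this, TensorProduct.map_add_right,
          LinearMap.add_apply]
      | tmul u v =>
        induction t using TensorProduct.induction_on with
        | zero => simp
        | add t t' ht ht' => simp only [mul_add, map_add, ht, ht']
        | tmul p q => simp [antipodeLin_mul, mul_assoc]
    have h3 : ∀ (r : k) (t : EHopf k n ⊗[k] EHopf k n),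
        LinearMap.mul' k _ (TensorProduct.map (antipodeLin k n)
          (LinearMap.mulLeft k (algebraMap k _ r)) t) =
        r • LinearMap.mul' k _ ((antipodeLin k n).rTensor _ t) := by
      intro r t
      induction t using TensorProduct.induction_on with
      | zero => simp
      | add t t' ht ht' => simp only [map_add, ht, ht', smul_add]
      | tmul p q => simp [Algebra.algebraMap_eq_smul_one]
    rw [Bialgebra.comul_mul, key, h1, h3, h2, Bialgebra.counit_mul, map_mul, Algebra.smul_def]

theorem antipode_right (a : EHopf k n) :
    LinearMap.mul' k _ ((antipodeLin k n).lTensor _ (Coalgebra.comul (R := k) a)) =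
      algebraMap k _ (Coalgebra.counit (R := k) a) := by
  induction a using EHopf.induction with
  | hs a => simp [Algebra.algebraMap_eq_smul_one, antipodeLin_one, Algebra.TensorProduct.one_def]
  | hc => simp [comul_c, counit_c, antipodeLin_c, c_mul_c]
  | hx i => simp [comul_x, counit_x, antipodeLin_x, antipodeLin_c, c_x_add]
  | ha a b h1 h2 => simp only [map_add, h1, h2]
  | hm a b h1 h2 =>
    have key : ∀ (s t : EHopf k n ⊗[k] EHopf k n),
        LinearMap.mul' k _ ((antipodeLin k n).lTensor _ (s * t)) =
        LinearMap.mul' k _ (TensorProduct.map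
          (LinearMap.mulRight k (LinearMap.mul' k _ ((antipodeLin k n).lTensor _ t)))
          (antipodeLin k n) s) := by
      intro s t
      induction t using TensorProduct.induction_on with
      | zero => simp
      | add s s' hs hs' =>
        have : ∀ u v : EHopf k n, LinearMap.mulRight k (u + v) = LinearMap.mulRight k u +
          LinearMap.mulRight k v := fun u v => by ext; simp [mul_add]
        simp only [mul_add, map_add, hs, hs', this, TensorProduct.map_add_left,
          LinearMap.add_apply]
      | tmul u v =>
        induction s using TensorProduct.induction_on with
        | zero => simp
        | add t t' ht ht' => simp only [add_mul, map_add, ht, ht']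
        | tmul p q => simp [antipodeLin_mul, mul_assoc]
    have h3 : ∀ (r : k) (t : EHopf k n ⊗[k] EHopf k n),
        LinearMap.mul' k _ (TensorProduct.map
          (LinearMap.mulRight k (algebraMap k _ r)) (antipodeLin k n) t) =
        r • LinearMap.mul' k _ ((antipodeLin k n).lTensor _ t) := by
      intro r t
      induction t using TensorProduct.induction_on with
      | zero => simp
      | add t t' ht ht' => simp only [map_add, ht, ht', smul_add]
      | tmul p q => simp [Algebra.algebraMap_eq_smul_one]
    rw [Bialgebra.comul_mul, key, h2, h3, h1, Bialgebra.counit_mul, Algebra.smul_def, ← map_mul,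
      mul_comm]

instance : HopfAlgebra k (EHopf k n) where
  antipode := antipodeLin k n
  mul_antipode_rTensor_comul := LinearMap.ext (antipode_left k)
  mul_antipode_lTensor_comul := LinearMap.ext (antipode_right k)

/-! ### The basis `c^a x_P` of `E(n)` -/

/-- `x_P` is the product of the `xⱼ`, `j ∈ P`, in increasing order. -/
def xProd (P : Finset (Fin n)) : EHopf k n := ((P.sort (· ≤ ·)).map (x k)).prod

/-- The monomials `x_P` (for `(false, P)`) and `c x_P` (for `(true, P)`). -/
def mon (p : Bool × Finset (Fin n)) : EHopf k n := (if p.1 then c k else 1) * xProd k p.2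

/-- Left multiplication by `c` on formal combinations of monomials. -/
def repC : Module.End k ((Bool × Finset (Fin n)) →₀ k) :=
  Finsupp.linearCombination k fun p => Finsupp.single (!p.1, p.2) 1

/-- Left multiplication by `xᵢ` on formal combinations of monomials. -/
def repX (i : Fin n) : Module.End k ((Bool × Finset (Fin n)) →₀ k) :=
  Finsupp.linearCombination k fun p => if i ∈ p.2 then 0 else
    Finsupp.single (p.1, insert i p.2) ((-1) ^ (p.1.toNat + (p.2.filter (· < i)).card))

theorem repC_single (p : Bool × Finset (Fin n)) (a : k) :
    repC k (Finsupp.single p a) = Finsupp.single (!p.1, p.2) a := by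
  simp [repC]

theorem repX_single (i : Fin n) (p : Bool × Finset (Fin n)) (a : k) :
    repX k i (Finsupp.single p a) = if i ∈ p.2 then 0 else
      Finsupp.single (p.1, insert i p.2)
        (a * (-1) ^ (p.1.toNat + (p.2.filter (· < i)).card)) := by
  simp [repX]

theorem repX_repX (i j : Fin n) (hij : i < j) (p : Bool × Finset (Fin n)) (a : k) :
    repX k i (repX k j (Finsupp.single p a)) = -repX k j (repX k i (Finsupp.single p a)) := by
  by_cases hi : i ∈ p.2
  · by_cases hj : j ∈ p.2 <;> simp [-Finsupp.single_mul, repX_single, hi, hj]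
  by_cases hj : j ∈ p.2
  · simp [-Finsupp.single_mul, repX_single, hi, hj]
  have e1 : (insert j p.2).filter (· < i) = p.2.filter (· < i) := by
    rw [Finset.filter_insert, if_neg (by simpa using hij.le)]
  have e2 : ((insert i p.2).filter (· < j)).card = (p.2.filter (· < j)).card + 1 := by
    rw [Finset.filter_insert, if_pos hij, Finset.card_insert_of_notMem (by simp [hi])]
  simp only [repX_single, hi, hj, if_false, Finset.mem_insert, hij.ne, hij.ne', or_self, e1, e2,
    Finset.insert_comm i j, ← Finsupp.single_neg]
  congr 1
  ring

variable (n) in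
/-- The left regular representation of `E(n)` in terms of monomials. -/
def rep : EHopf k n →ₐ[k] Module.End k ((Bool × Finset (Fin n)) →₀ k) :=
  lift (repC k) (repX k)
    (by
      refine Finsupp.lhom_ext fun p a => ?_
      simp [repC_single])
    (fun i => by
      refine Finsupp.lhom_ext fun p a => ?_
      obtain ⟨b, P⟩ := p
      by_cases hi : i ∈ P
      · simp [-Finsupp.single_mul, repC_single, repX_single, hi]
      · cases b <;> simp [-Finsupp.single_mul, repC_single, repX_single, hi, pow_add])
    (fun i j => by
      refine Finsupp.lhom_ext fun p a => ?_
      rcases lt_trichotomy i j with h | rfl | h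
      · simp [repX_repX k i j h]
      · by_cases hi : i ∈ p.2 <;> simp [-Finsupp.single_mul, repX_single, hi]
      · simp [repX_repX k j i h])
    (fun i => by
      refine Finsupp.lhom_ext fun p a => ?_
      by_cases hi : i ∈ p.2 <;> simp [-Finsupp.single_mul, repX_single, hi])

theorem rep_prod (l : List (Fin n)) (hl : l.Pairwise (· < ·)) :
    rep k n (l.map (x k)).prod (Finsupp.single (false, ∅) 1) =
      Finsupp.single (false, l.toFinset) 1 := by
  induction l with
  | nil => simp
  | cons i l ih =>
    rw [List.pairwise_cons] at hl
    have h1 : i ∉ l := fun h => lt_irrefl _ (hl.1 i h)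
    have h2 : l.toFinset.filter (· < i) = ∅ := by
      ext j
      simpa using fun h => (hl.1 j h).le
    rw [List.map_cons, List.prod_cons, map_mul, Module.End.mul_apply, ih hl.2]
    simp [rep, repX_single, h1, h2]

theorem rep_mon (p : Bool × Finset (Fin n)) :
    rep k n (mon k p) (Finsupp.single (false, ∅) 1) = Finsupp.single p 1 := by
  obtain ⟨b, P⟩ := p
  have h := rep_prod k (P.sort (· ≤ ·)) (Finset.sortedLT_sort P).pairwise
  rw [Finset.sort_toFinset] at h
  cases b
  · simp [mon, xProd, h]
  · simp only [mon, xProd, if_true, map_mul, Module.End.mul_apply, h]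
    simp [rep, repC_single]

theorem linearIndependent_mon : LinearIndependent k (mon k (n := n)) := by
  refine LinearIndependent.of_comp
    ((LinearMap.applyₗ (Finsupp.single (false, ∅) 1)).comp (rep k n).toLinearMap) ?_
  have : ⇑((LinearMap.applyₗ (Finsupp.single (false, ∅) 1)).comp (rep k n).toLinearMap) ∘
      mon k = fun p => Finsupp.single p 1 := by
    funext p
    simpa using rep_mon k p
  rw [this]
  exact Finsupp.linearIndependent_single_one k _

theorem x_mul_prod (l : List (Fin n)) (hl : l.Pairwise (· < ·)) (i : Fin n) :
    ∃ (s : k) (l' : List (Fin n)), l'.Pairwise (· < ·) ∧ (∀ j ∈ l', j = i ∨ j ∈ l) ∧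
      x k i * (l.map (x k)).prod = s • (l'.map (x k)).prod := by
  induction l with
  | nil => exact ⟨1, [i], by simp, by simp, by simp⟩
  | cons j l ih =>
    rcases lt_trichotomy i j with h | rfl | h
    · refine ⟨1, i :: j :: l, ?_, by simp, by simp⟩
      rw [List.pairwise_cons]
      refine ⟨fun m hm => ?_, hl⟩
      rcases List.mem_cons.1 hm with rfl | hm
      · exact h
      · exact h.trans ((List.pairwise_cons.1 hl).1 m hm)
    · exact ⟨0, [], by simp, by simp, by simp [← mul_assoc, x_mul_x]⟩
    · rw [List.pairwise_cons] at hl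
      obtain ⟨s, l', h1, h2, h3⟩ := ih hl.2
      refine ⟨-s, j :: l', ?_, ?_, ?_⟩
      · rw [List.pairwise_cons]
        refine ⟨fun m hm => ?_, h1⟩
        rcases h2 m hm with rfl | hm
        · exact h
        · exact hl.1 m hm
      · intro m hm
        rcases List.mem_cons.1 hm with rfl | hm
        · simp
        · rcases h2 m hm with rfl | hm <;> simp [*]
      · rw [List.map_cons, List.prod_cons, ← mul_assoc, x_mul_x_swap, neg_mul, mul_assoc, h3]
        simp

theorem prod_eq_xProd (l : List (Fin n)) (hl : l.Pairwise (· < ·)) :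
    (l.map (x k)).prod = xProd k l.toFinset := by
  rw [xProd, (List.toFinset_sort (· ≤ ·) (hl.imp fun h => h.ne)).2 (hl.imp fun h => h.le)]

theorem mul_mon_mem (a : EHopf k n) :
    ∀ v ∈ Submodule.span k (Set.range (mon k (n := n))),
      a * v ∈ Submodule.span k (Set.range (mon k (n := n))) := by
  have red : ∀ a : EHopf k n, (∀ p, a * mon k p ∈ Submodule.span k (Set.range (mon k (n := n)))) →
      ∀ v ∈ Submodule.span k (Set.range (mon k (n := n))),
        a * v ∈ Submodule.span k (Set.range (mon k (n := n))) := by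
    intro a h v hv
    induction hv using Submodule.span_induction with
    | mem v hv => obtain ⟨p, rfl⟩ := hv; exact h p
    | zero => simp
    | add u v _ _ hu hv => rw [mul_add]; exact add_mem hu hv
    | smul s v _ hv => rw [mul_smul_comm]; exact Submodule.smul_mem _ _ hv
  induction a using EHopf.induction with
  | hs a => intro v hv; rw [← Algebra.smul_def]; exact Submodule.smul_mem _ _ hv
  | hc =>
    refine red _ fun p => ?_
    obtain ⟨b, P⟩ := p
    refine Submodule.subset_span ⟨(!b, P), ?_⟩
    cases b <;> simp [mon, ← mul_assoc, c_mul_c]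
  | hx i =>
    refine red _ fun p => ?_
    obtain ⟨b, P⟩ := p
    obtain ⟨s, l', h1, -, h3⟩ := x_mul_prod k (P.sort (· ≤ ·)) (Finset.sortedLT_sort P).pairwise i
    rw [prod_eq_xProd k l' h1] at h3
    change x k i * xProd k P = _ at h3
    have hm : x k i * mon k (b, P) =
        (if b then -s else s) • mon k (b, l'.toFinset) := by
      cases b
      · simp [mon, h3]
      · simp only [mon, if_true]
        rw [← mul_assoc, x_mul_c, neg_mul, mul_assoc, h3]
        simp
    rw [hm]
    exact Submodule.smul_mem _ _ (Submodule.subset_span ⟨_, rfl⟩)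
  | hm a b h1 h2 => intro v hv; rw [mul_assoc]; exact h1 _ (h2 _ hv)
  | ha a b h1 h2 => intro v hv; rw [add_mul]; exact add_mem (h1 _ hv) (h2 _ hv)

theorem span_mon : ⊤ ≤ Submodule.span k (Set.range (mon k (n := n))) := by
  intro a _
  have h := mul_mon_mem k a 1 (Submodule.subset_span ⟨(false, ∅), by simp [mon, xProd]⟩)
  rwa [mul_one] at h

variable (n) in
/-- The basis of `E(n)` formed by the monomials `x_P` and `c x_P`. -/
def monBasis : Module.Basis (Bool × Finset (Fin n)) k (EHopf k n) :=
  Module.Basis.mk (linearIndependent_mon k) (span_mon k)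

instance : Module.Finite k (EHopf k n) := Module.Finite.of_basis (monBasis k n)

theorem monBasis_apply (p : Bool × Finset (Fin n)) : monBasis k n p = mon k p := by
  simp [monBasis]

/-- The dual basis element `(x_P)^*`. -/
def xDual (P : Finset (Fin n)) : Module.Dual k (EHopf k n) := (monBasis k n).coord (false, P)

/-- The dual basis element `(c x_P)^*`. -/
def cxDual (P : Finset (Fin n)) : Module.Dual k (EHopf k n) := (monBasis k n).coord (true, P)

variable {k}

/-- For `f, g ∈ E(n)^*`, the linear form `f ⊗ g` on `E(n) ⊗ E(n)`. -/
def dualTmul (f g : Module.Dual k (EHopf k n)) : EHopf k n ⊗[k] EHopf k n →ₗ[k] k :=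
  TensorProduct.dualDistrib k (EHopf k n) (EHopf k n) (f ⊗ₜ[k] g)

theorem dualTmul_tmul (f g : Module.Dual k (EHopf k n)) (a b : EHopf k n) :
    dualTmul f g (a ⊗ₜ[k] b) = f a * g b := by
  simp [dualTmul]

/-- The universal `r`-form `r_A` of `E(n)` attached to a matrix `A`. The sum is over subsets
`P, F` of `{1, …, n}` with `|P| = |F|` (written increasingly as `p₁ < … < p_s`, `f₁ < … < f_s`) and
over permutations `η` of `s = |P|` letters; the coefficient is
`(-1)^{s(s-1)/2} sign(η) a_{p₁, f_{η(1)}} ⋯ a_{p_s, f_{η(s)}}`. -/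
def rForm (A : Matrix (Fin n) (Fin n) k) : EHopf k n ⊗[k] EHopf k n →ₗ[k] k :=
  ∑ P : Finset (Fin n), (-1 : k) ^ (P.card * (P.card - 1) / 2) •
    ∑ F : {F : Finset (Fin n) // F.card = P.card}, ∑ η : Equiv.Perm (Fin P.card),
      (((Equiv.Perm.sign η : ℤ) : k) *
          ∏ i : Fin P.card, A (P.orderEmbOfFin rfl i) (F.1.orderEmbOfFin F.2 (η i))) •
        (dualTmul (xDual k P) (xDual k F.1) + dualTmul (cxDual k P) (xDual k F.1) +
          (-1 : k) ^ P.card • dualTmul (xDual k P) (cxDual k F.1) -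
          (-1 : k) ^ P.card • dualTmul (cxDual k P) (cxDual k F.1))

end EHopf

end

open scoped TensorProduct

noncomputable section

/-! Write χ for the character of E(n) with c ↦ -1, xᵢ ↦ 0. The form r_A is determined by
multiplicativity and its values on generators: r(c ⊗ -) is χ, and r(xᵢ ⊗ -) is the skew-primitive
form taking xⱼ to a_{ij} and vanishing on c. Rather than attack the explicit sum, the proof builds
such a form abstractly. The operators h ↦ ∑ r(a ⊗ h₁)h₂ must depend antimultiplicatively on a. For a
= c and a = xᵢ they are an involution and skew derivations, and these satisfy the relations of E(n),
so the universal property gives `act`, and `pairing` is ε ∘ `act`. The axioms of a universal r-form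
then reduce to generators, and r ∘ (S ⊗ id) is the convolution inverse (`pairing_isUniversalRForm`).
On monomials the skew derivations produce a Laplace expansion, so the pairing of two words of length
m is (-1)^{m(m-1)/2} times a minor of A, and words of different lengths are orthogonal; hence the
form is r_A (`rForm_eq`).

If A is singular, some nonzero y = ∑ vⱼxⱼ pairs to zero with everything. Then G sends both y ⊗ 1 and
1 ⊗ y to left multiplication by y in E(n), and G is not injective.

If det A ≠ 0, the pairing is nondegenerate. The left radical is a right ideal, and every nonzero
element of E(n) has a right multiple αx_top + βcx_top ≠ 0, where x_top = x₁⋯xₙ. Pairing this with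
x_top and cx_top gives ±(α ± β)det A, which cannot both vanish in characteristic other than 2. So
every linear form is r(a ⊗ -) for some a, and also r(- ⊗ b) for some b. Cancelling with the antipode
or its inverse, the image of G contains all maps d ↦ ∑ φ(d₁)d₂ and that of F all maps d ↦ ∑ d₂φ(d₁),
with φ an arbitrary endomorphism. Every endomorphism has both forms, because convolution by the
identity is invertible, so F and G are surjective. They are bijective by dimension count. -/

section Hit

variable {k : Type*} [Field k]

/-! ### Convolution of linear forms and the operators they induce on a coalgebra -/

section Coalgebra

variable {H : Type*} [AddCommGroup H] [Module k H] [Coalgebra k H]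

/-- The operator `h ↦ ∑ f(h₁) h₂` attached to a linear form `f`. -/
def hitLeft (f : H →ₗ[k] k) : H →ₗ[k] H :=
  (TensorProduct.lid k H).toLinearMap ∘ₗ f.rTensor H ∘ₗ Coalgebra.comul

/-- The operator `h ↦ ∑ h₁ f(h₂)` attached to a linear form `f`. -/
def hitRight (f : H →ₗ[k] k) : H →ₗ[k] H :=
  (TensorProduct.rid k H).toLinearMap ∘ₗ f.lTensor H ∘ₗ Coalgebra.comul

/-- The convolution product `h ↦ ∑ f(h₁) g(h₂)` of linear forms. -/
def convDual (f g : H →ₗ[k] k) : H →ₗ[k] k :=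
  LinearMap.mul' k k ∘ₗ TensorProduct.map f g ∘ₗ Coalgebra.comul

theorem hitLeft_apply (f : H →ₗ[k] k) (h : H) :
    hitLeft f h = TensorProduct.lid k H (f.rTensor H (Coalgebra.comul h)) := rfl

theorem hitRight_apply (f : H →ₗ[k] k) (h : H) :
    hitRight f h = TensorProduct.rid k H (f.lTensor H (Coalgebra.comul h)) := rfl

theorem convDual_apply (f g : H →ₗ[k] k) (h : H) :
    convDual f g h = LinearMap.mul' k k (TensorProduct.map f g (Coalgebra.comul h)) := rfl

theorem apply_hitLeft (f g : H →ₗ[k] k) (h : H) : g (hitLeft f h) = convDual f g h := by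
  rw [hitLeft_apply, convDual_apply]
  generalize (Coalgebra.comul h : H ⊗[k] H) = t
  induction t using TensorProduct.induction_on with
  | zero => simp
  | add s t hs ht => simp only [map_add, hs, ht]
  | tmul u v => simp

theorem apply_hitRight (f g : H →ₗ[k] k) (h : H) : g (hitRight f h) = convDual g f h := by
  rw [hitRight_apply, convDual_apply]
  generalize (Coalgebra.comul h : H ⊗[k] H) = t
  induction t using TensorProduct.induction_on with
  | zero => simp
  | add s t hs ht => simp only [map_add, hs, ht]
  | tmul u v => simp [mul_comm]

theorem convDual_counit_right (f : H →ₗ[k] k) : convDual f Coalgebra.counit = f := by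
  ext h
  rw [← apply_hitRight, hitRight_apply, Coalgebra.lTensor_counit_comul]
  simp

theorem counit_hitLeft (f : H →ₗ[k] k) (h : H) :
    Coalgebra.counit (R := k) (hitLeft f h) = f h := by
  rw [apply_hitLeft, convDual_counit_right]

theorem hitLeft_counit : hitLeft (Coalgebra.counit (R := k) (A := H)) = LinearMap.id := by
  ext h
  rw [hitLeft_apply, Coalgebra.rTensor_counit_comul]
  simp

theorem hitRight_counit : hitRight (Coalgebra.counit (R := k) (A := H)) = LinearMap.id := by
  ext h
  rw [hitRight_apply, Coalgebra.lTensor_counit_comul]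
  simp

/-- By coassociativity both sides are ∑ g(h₁)f(h₂)h₃. The form applied first consumes the first leg,
which is why the order reverses here and not in `hitRight_hitRight`. -/
theorem hitLeft_hitLeft (f g : H →ₗ[k] k) :
    hitLeft f ∘ₗ hitLeft g = hitLeft (convDual g f) := by
  -- The coproduct is replaced by an arbitrary tensor t, where both sides are linear and pure
  -- tensors suffice. Coassociativity enters only once, at the end. The same scheme serves for every
  -- Sweedler computation below.
  have h1 : ∀ t : H ⊗[k] H, hitLeft f (TensorProduct.lid k H (g.rTensor H t)) =
      TensorProduct.lid k H (TensorProduct.map g ((TensorProduct.lid k H).toLinearMap ∘ₗ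
        f.rTensor H) ((Coalgebra.comul (R := k)).lTensor H t)) := by
    intro t
    induction t using TensorProduct.induction_on with
    | zero => simp
    | add s t hs ht => simp only [map_add, hs, ht]
    | tmul u v => simp [hitLeft_apply]
  have h2 : ∀ (t : H ⊗[k] H) (v : H), TensorProduct.lid k H (TensorProduct.map g
      ((TensorProduct.lid k H).toLinearMap ∘ₗ f.rTensor H)
        (TensorProduct.assoc k H H H (t ⊗ₜ[k] v))) =
      LinearMap.mul' k k (TensorProduct.map g f t) • v := by
    intro t v
    induction t using TensorProduct.induction_on with
    | zero => simp
    | add s t hs ht => simp only [map_add, TensorProduct.add_tmul, hs, ht, add_smul]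
    | tmul p q => simp [smul_smul, mul_comm]
  have h3 : ∀ t : H ⊗[k] H, TensorProduct.lid k H (TensorProduct.map g
      ((TensorProduct.lid k H).toLinearMap ∘ₗ f.rTensor H)
        (TensorProduct.assoc k H H H ((Coalgebra.comul (R := k)).rTensor H t))) =
      TensorProduct.lid k H ((convDual g f).rTensor H t) := by
    intro t
    induction t using TensorProduct.induction_on with
    | zero => simp
    | add s t hs ht => simp only [map_add, hs, ht]
    | tmul u v =>
      rw [LinearMap.rTensor_tmul, h2]
      simp [convDual_apply]
  ext h
  rw [LinearMap.comp_apply, hitLeft_apply g, h1, ← Coalgebra.coassoc_apply, h3, ← hitLeft_apply]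

theorem hitRight_hitRight (f g : H →ₗ[k] k) :
    hitRight f ∘ₗ hitRight g = hitRight (convDual f g) := by
  have h1 : ∀ t : H ⊗[k] H, hitRight f (TensorProduct.rid k H (g.lTensor H t)) =
      TensorProduct.rid k H (TensorProduct.map ((TensorProduct.rid k H).toLinearMap ∘ₗ
        f.lTensor H) g ((Coalgebra.comul (R := k)).rTensor H t)) := by
    intro t
    induction t using TensorProduct.induction_on with
    | zero => simp
    | add s t hs ht => simp only [map_add, hs, ht]
    | tmul u v => simp [hitRight_apply]
  have h2 : ∀ (t : H ⊗[k] H) (v : H), TensorProduct.rid k H (TensorProduct.map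
      ((TensorProduct.rid k H).toLinearMap ∘ₗ f.lTensor H) g
        ((TensorProduct.assoc k H H H).symm (v ⊗ₜ[k] t))) =
      LinearMap.mul' k k (TensorProduct.map f g t) • v := by
    intro t v
    induction t using TensorProduct.induction_on with
    | zero => simp
    | add s t hs ht => simp only [map_add, TensorProduct.tmul_add, hs, ht, add_smul]
    | tmul p q => simp [smul_smul, mul_comm]
  have h3 : ∀ t : H ⊗[k] H, TensorProduct.rid k H (TensorProduct.map
      ((TensorProduct.rid k H).toLinearMap ∘ₗ f.lTensor H) g
        ((TensorProduct.assoc k H H H).symm ((Coalgebra.comul (R := k)).lTensor H t))) =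
      TensorProduct.rid k H ((convDual f g).lTensor H t) := by
    intro t
    induction t using TensorProduct.induction_on with
    | zero => simp
    | add s t hs ht => simp only [map_add, hs, ht]
    | tmul u v =>
      rw [LinearMap.lTensor_tmul, h2]
      simp [convDual_apply]
  ext h
  rw [LinearMap.comp_apply, hitRight_apply g, h1, ← Coalgebra.coassoc_symm_apply, h3,
    ← hitRight_apply]

theorem hitLeft_hitRight (f g : H →ₗ[k] k) (h : H) :
    hitLeft f (hitRight g h) = hitRight g (hitLeft f h) := by
  have h1 : ∀ t : H ⊗[k] H, hitLeft f (TensorProduct.rid k H (g.lTensor H t)) =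
      TensorProduct.lid k H (TensorProduct.map f ((TensorProduct.rid k H).toLinearMap ∘ₗ
        g.lTensor H) (TensorProduct.assoc k H H H ((Coalgebra.comul (R := k)).rTensor H t))) := by
    have h0 : ∀ (t : H ⊗[k] H) (v : H), TensorProduct.lid k H (TensorProduct.map f
        ((TensorProduct.rid k H).toLinearMap ∘ₗ g.lTensor H)
          (TensorProduct.assoc k H H H (t ⊗ₜ[k] v))) =
        g v • TensorProduct.lid k H (f.rTensor H t) := by
      intro t v
      induction t using TensorProduct.induction_on with
      | zero => simp
      | add s t hs ht => simp only [map_add, TensorProduct.add_tmul, hs, ht, smul_add]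
      | tmul p q => simp [smul_smul, mul_comm]
    intro t
    induction t using TensorProduct.induction_on with
    | zero => simp
    | add s t hs ht => simp only [map_add, hs, ht]
    | tmul u v =>
      rw [LinearMap.rTensor_tmul, h0]
      simp [hitLeft_apply]
  have h2 : ∀ t : H ⊗[k] H, hitRight g (TensorProduct.lid k H (f.rTensor H t)) =
      TensorProduct.lid k H (TensorProduct.map f ((TensorProduct.rid k H).toLinearMap ∘ₗ
        g.lTensor H) ((Coalgebra.comul (R := k)).lTensor H t)) := by
    intro t
    induction t using TensorProduct.induction_on with
    | zero => simp
    | add s t hs ht => simp only [map_add, hs, ht]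
    | tmul u v => simp [hitRight_apply]
  rw [hitRight_apply, h1, hitLeft_apply, h2, Coalgebra.coassoc_apply]

end Coalgebra

/-! ### Leibniz rules inherited from the multiplicativity of the coproduct -/

section Bialgebra

variable {H : Type*} [Ring H] [Bialgebra k H]

/-- Two summands are allowed so that one statement covers characters (second summand zero) and
skew-primitive forms, whose operators become skew derivations. -/
theorem hitLeft_mul {f g h g' h' : H →ₗ[k] k}
    (hf : ∀ a b, f (a * b) = g a * h b + g' a * h' b) (a b : H) :
    hitLeft f (a * b) = hitLeft g a * hitLeft h b + hitLeft g' a * hitLeft h' b := by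
  simp only [hitLeft_apply, Bialgebra.comul_mul]
  generalize (Coalgebra.comul a : H ⊗[k] H) = s
  generalize (Coalgebra.comul b : H ⊗[k] H) = t
  induction s using TensorProduct.induction_on with
  | zero => simp
  | add s s' hs hs' =>
    simp only [map_add, add_mul, hs, hs']
    abel
  | tmul u v =>
    induction t using TensorProduct.induction_on with
    | zero => simp
    | add t t' ht ht' =>
      simp only [map_add, mul_add, ht, ht']
      abel
    | tmul p q => simp [hf, add_smul, smul_smul, mul_comm]

theorem hitRight_mul {f g h g' h' : H →ₗ[k] k}
    (hf : ∀ a b, f (a * b) = g a * h b + g' a * h' b) (a b : H) :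
    hitRight f (a * b) = hitRight g a * hitRight h b + hitRight g' a * hitRight h' b := by
  simp only [hitRight_apply, Bialgebra.comul_mul]
  generalize (Coalgebra.comul a : H ⊗[k] H) = s
  generalize (Coalgebra.comul b : H ⊗[k] H) = t
  induction s using TensorProduct.induction_on with
  | zero => simp
  | add s s' hs hs' =>
    simp only [map_add, add_mul, hs, hs']
    abel
  | tmul u v =>
    induction t using TensorProduct.induction_on with
    | zero => simp
    | add t t' ht ht' =>
      simp only [map_add, mul_add, ht, ht']
      abel
    | tmul p q => simp [hf, add_smul, smul_smul, mul_comm]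

theorem hitLeft_zero : hitLeft (0 : H →ₗ[k] k) = 0 := by
  simp [hitLeft]

theorem hitRight_zero : hitRight (0 : H →ₗ[k] k) = 0 := by
  simp [hitRight]

theorem hitLeft_map_mul {f : H →ₗ[k] k} (hf : ∀ a b, f (a * b) = f a * f b) (a b : H) :
    hitLeft f (a * b) = hitLeft f a * hitLeft f b := by
  have h := hitLeft_mul (f := f) (g := f) (h := f) (g' := 0) (h' := 0) (by simpa using hf) a b
  simpa [hitLeft_zero] using h

theorem hitRight_map_mul {f : H →ₗ[k] k} (hf : ∀ a b, f (a * b) = f a * f b) (a b : H) :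
    hitRight f (a * b) = hitRight f a * hitRight f b := by
  have h := hitRight_mul (f := f) (g := f) (h := f) (g' := 0) (h' := 0) (by simpa using hf) a b
  simpa [hitRight_zero] using h

theorem hitLeft_one (f : H →ₗ[k] k) : hitLeft f 1 = f 1 • 1 := by
  simp [hitLeft_apply, Algebra.TensorProduct.one_def]

theorem hitRight_one (f : H →ₗ[k] k) : hitRight f 1 = f 1 • 1 := by
  simp [hitRight_apply, Algebra.TensorProduct.one_def]

end Bialgebra

end Hit

/-! ### Skew-primitive forms on E(n) and their skew derivations -/

namespace EHopf

variable {k : Type*} [Field k] {n : ℕ}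

variable (k n) in
/-- The character of `E(n)` with `c ↦ -1` and `xᵢ ↦ 0`. -/
def signChar : EHopf k n →ₐ[k] k :=
  lift (-1) (fun _ => 0) (by simp) (by simp) (by simp) (by simp)

theorem signChar_c : signChar k n (c k) = -1 := lift_c

theorem signChar_x (i : Fin n) : signChar k n (x k i) = 0 := lift_x i

/-- The two-dimensional representation of `E(n)` attached to the `i`-th row of a matrix. -/
def rowRep (A : Matrix (Fin n) (Fin n) k) (i : Fin n) :
    EHopf k n →ₐ[k] Matrix (Fin 2) (Fin 2) k :=
  lift !![-1, 0; 0, 1] (fun j => !![0, A i j; 0, 0])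
    (by simp [Matrix.one_fin_two]) (fun j => by ext p q; fin_cases p <;> fin_cases q <;> simp)
    (fun j l => by ext p q; fin_cases p <;> fin_cases q <;> simp)
    (fun j => by ext p q; fin_cases p <;> fin_cases q <;> simp)

/-- The skew-primitive linear form on `E(n)` with `xⱼ ↦ a_{ij}`. -/
def rowForm (A : Matrix (Fin n) (Fin n) k) (i : Fin n) : EHopf k n →ₗ[k] k :=
  Matrix.entryLinearMap k k 0 1 ∘ₗ (rowRep A i).toLinearMap

/-- The representation is upper triangular with the characters χ and ε on its diagonal. Multiplying
two such matrices turns the corner entry into a (χ, ε)-derivation, which is `rowForm_mul`. -/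
theorem rowRep_eq (A : Matrix (Fin n) (Fin n) k) (i : Fin n) (a : EHopf k n) :
    rowRep A i a = !![signChar k n a, rowForm A i a; 0, Coalgebra.counit (R := k) a] := by
  have h01 : ∀ a, rowForm A i a = rowRep A i a 0 1 := fun a => rfl
  have : rowRep A i a 0 0 = signChar k n a ∧ rowRep A i a 1 0 = 0 ∧
      rowRep A i a 1 1 = Coalgebra.counit (R := k) a := by
    induction a using EHopf.induction with
    | hs a => simp [Matrix.algebraMap_matrix_apply]
    | hc => simp [rowRep, signChar_c, counit_c]
    | hx i => simp [rowRep, signChar_x, counit_x]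
    | hm a b ha hb => simp [Matrix.mul_apply, ha, hb]
    | ha a b ha hb => simp [ha, hb]
  ext p q
  fin_cases p <;> fin_cases q <;> simp [this, h01]

theorem rowForm_mul (A : Matrix (Fin n) (Fin n) k) (i : Fin n) (a b : EHopf k n) :
    rowForm A i (a * b) = rowForm A i a * Coalgebra.counit (R := k) b +
      signChar k n a * rowForm A i b := by
  have h : rowForm A i (a * b) = (rowRep A i a * rowRep A i b) 0 1 := by
    rw [← map_mul]; rfl
  rw [h, rowRep_eq, rowRep_eq]
  simp
  ring

theorem rowForm_one (A : Matrix (Fin n) (Fin n) k) (i : Fin n) : rowForm A i 1 = 0 := by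
  simp [rowForm]

theorem rowForm_c (A : Matrix (Fin n) (Fin n) k) (i : Fin n) : rowForm A i (c k) = 0 := by
  simp [rowForm, rowRep]

theorem rowForm_x (A : Matrix (Fin n) (Fin n) k) (i j : Fin n) :
    rowForm A i (x k j) = A i j := by
  simp [rowForm, rowRep]

variable (k n) in
/-- The algebra endomorphism `c ↦ -c`, `xᵢ ↦ xᵢ`. -/
def leftSign : EHopf k n →ₗ[k] EHopf k n := hitLeft (signChar k n).toLinearMap

/-- The skew derivation of `E(n)` with `xⱼ ↦ a_{ij} c`, `c ↦ 0`. -/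
def leftDer (A : Matrix (Fin n) (Fin n) k) (i : Fin n) : EHopf k n →ₗ[k] EHopf k n :=
  hitLeft (rowForm A i)

variable (k n) in
/-- The algebra endomorphism `c ↦ -c`, `xᵢ ↦ -xᵢ`. -/
def rightSign : EHopf k n →ₗ[k] EHopf k n := hitRight (signChar k n).toLinearMap

/-- The skew derivation of `E(n)` with `xⱼ ↦ a_{ij}`, `c ↦ 0`. -/
def rightDer (A : Matrix (Fin n) (Fin n) k) (i : Fin n) : EHopf k n →ₗ[k] EHopf k n :=
  hitRight (rowForm A i)

theorem leftSign_mul (a b : EHopf k n) :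
    leftSign k n (a * b) = leftSign k n a * leftSign k n b :=
  hitLeft_map_mul (by simp) a b

theorem rightSign_mul (a b : EHopf k n) :
    rightSign k n (a * b) = rightSign k n a * rightSign k n b :=
  hitRight_map_mul (by simp) a b

theorem leftDer_mul (A : Matrix (Fin n) (Fin n) k) (i : Fin n) (a b : EHopf k n) :
    leftDer A i (a * b) = leftDer A i a * b + leftSign k n a * leftDer A i b := by
  have h := hitLeft_mul (g := rowForm A i) (h := Coalgebra.counit (R := k))
    (g' := (signChar k n).toLinearMap) (h' := rowForm A i) (rowForm_mul A i) a b
  rwa [hitLeft_counit] at h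

theorem rightDer_mul (A : Matrix (Fin n) (Fin n) k) (i : Fin n) (a b : EHopf k n) :
    rightDer A i (a * b) = rightDer A i a * b + rightSign k n a * rightDer A i b := by
  have h := hitRight_mul (g := rowForm A i) (h := Coalgebra.counit (R := k))
    (g' := (signChar k n).toLinearMap) (h' := rowForm A i) (rowForm_mul A i) a b
  rwa [hitRight_counit] at h

theorem leftSign_algebraMap (a : k) :
    leftSign k n (algebraMap k _ a) = algebraMap k _ a := by
  simp [Algebra.algebraMap_eq_smul_one, leftSign, hitLeft_one]

theorem rightSign_algebraMap (a : k) :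
    rightSign k n (algebraMap k _ a) = algebraMap k _ a := by
  simp [Algebra.algebraMap_eq_smul_one, rightSign, hitRight_one]

theorem leftDer_algebraMap (A : Matrix (Fin n) (Fin n) k) (i : Fin n) (a : k) :
    leftDer A i (algebraMap k _ a) = 0 := by
  simp [Algebra.algebraMap_eq_smul_one, leftDer, hitLeft_one, rowForm_one]

theorem rightDer_algebraMap (A : Matrix (Fin n) (Fin n) k) (i : Fin n) (a : k) :
    rightDer A i (algebraMap k _ a) = 0 := by
  simp [Algebra.algebraMap_eq_smul_one, rightDer, hitRight_one, rowForm_one]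

theorem leftSign_c : leftSign k n (c k) = -c k := by
  simp [leftSign, hitLeft_apply, comul_c, signChar_c]

theorem leftSign_x (i : Fin n) : leftSign k n (x k i) = x k i := by
  simp [leftSign, hitLeft_apply, comul_x, signChar_x]

theorem rightSign_c : rightSign k n (c k) = -c k := by
  simp [rightSign, hitRight_apply, comul_c, signChar_c]

theorem rightSign_x (i : Fin n) : rightSign k n (x k i) = -x k i := by
  simp [rightSign, hitRight_apply, comul_x, signChar_x, signChar_c]

theorem leftDer_c (A : Matrix (Fin n) (Fin n) k) (i : Fin n) : leftDer A i (c k) = 0 := by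
  simp [leftDer, hitLeft_apply, comul_c, rowForm_c]

theorem leftDer_x (A : Matrix (Fin n) (Fin n) k) (i j : Fin n) :
    leftDer A i (x k j) = A i j • c k := by
  simp [leftDer, hitLeft_apply, comul_x, rowForm_one, rowForm_x]

theorem rightDer_c (A : Matrix (Fin n) (Fin n) k) (i : Fin n) : rightDer A i (c k) = 0 := by
  simp [rightDer, hitRight_apply, comul_c, rowForm_c]

theorem rightDer_x (A : Matrix (Fin n) (Fin n) k) (i j : Fin n) :
    rightDer A i (x k j) = A i j • 1 := by
  simp [rightDer, hitRight_apply, comul_x, rowForm_c, rowForm_x]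

/-- This and the next three lemmas are the defining relations of E(n) for the operators `leftSign`
and `leftDer`, which is what `leftAct` requires. -/
theorem leftSign_leftSign (a : EHopf k n) : leftSign k n (leftSign k n a) = a := by
  induction a using EHopf.induction with
  | hs a => simp [leftSign_algebraMap]
  | hc => simp [leftSign_c]
  | hx i => simp [leftSign_x]
  | hm a b ha hb => simp [leftSign_mul, ha, hb]
  | ha a b ha hb => simp [ha, hb]

theorem leftSign_leftDer (A : Matrix (Fin n) (Fin n) k) (i : Fin n) (a : EHopf k n) :
    leftSign k n (leftDer A i a) = -leftDer A i (leftSign k n a) := by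
  induction a using EHopf.induction with
  | hs a => simp [leftSign_algebraMap, leftDer_algebraMap]
  | hc => simp [leftSign_c, leftDer_c]
  | hx i => simp [leftSign_x, leftDer_x, leftSign_c]
  | hm a b ha hb => simp [leftSign_mul, leftDer_mul, ha, hb, add_comm]
  | ha a b ha hb => simp [ha, hb, add_comm]

theorem leftDer_leftDer (A : Matrix (Fin n) (Fin n) k) (i j : Fin n) (a : EHopf k n) :
    leftDer A i (leftDer A j a) + leftDer A j (leftDer A i a) = 0 := by
  induction a using EHopf.induction with
  | hs a => simp [leftDer_algebraMap]
  | hc => simp [leftDer_c]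
  | hx i => simp [leftDer_x, leftDer_c]
  | hm a b ha hb =>
    -- The mixed terms, with one derivation on each factor, cancel in pairs because `leftSign`
    -- anticommutes with each derivation.
    simp only [leftDer_mul, map_add, leftSign_leftDer, leftSign_leftSign]
    have : leftDer A i (leftDer A j a) * b + leftDer A j (leftDer A i a) * b +
        (a * leftDer A i (leftDer A j b) + a * leftDer A j (leftDer A i b)) = 0 := by
      rw [← add_mul, ← mul_add, ha, hb]; simp
    rw [← this]
    noncomm_ring
  | ha a b ha hb =>
    simp only [map_add]
    rw [add_add_add_comm, ha, hb, add_zero]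

theorem leftDer_leftDer_self (A : Matrix (Fin n) (Fin n) k) (i : Fin n) (a : EHopf k n) :
    leftDer A i (leftDer A i a) = 0 := by
  induction a using EHopf.induction with
  | hs a => simp [leftDer_algebraMap]
  | hc => simp [leftDer_c]
  | hx i => simp [leftDer_x, leftDer_c]
  | hm a b ha hb => simp [leftDer_mul, leftSign_leftDer, leftSign_leftSign, ha, hb]
  | ha a b ha hb => simp [ha, hb]

/-! ### The action of E(n) on itself and the pairing it defines -/

/-- The action `h ↦ ∑ r(a ⊗ h₁) h₂` of `a ∈ E(n)` on `E(n)`. -/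
def leftAct (A : Matrix (Fin n) (Fin n) k) :
    EHopf k n →ₐ[k] (Module.End k (EHopf k n))ᵐᵒᵖ :=
  lift (MulOpposite.op (leftSign k n)) (fun i => MulOpposite.op (leftDer A i))
    (by
      rw [← MulOpposite.op_mul, ← MulOpposite.op_one]
      congr 1
      ext a
      simp [leftSign_leftSign])
    (fun i => by
      rw [← MulOpposite.op_mul, ← MulOpposite.op_mul, ← MulOpposite.op_add,
        ← MulOpposite.op_zero]
      congr 1
      ext a
      simp [leftSign_leftDer])
    (fun i j => by
      rw [← MulOpposite.op_mul, ← MulOpposite.op_mul, ← MulOpposite.op_add,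
        ← MulOpposite.op_zero]
      congr 1
      ext a
      simp [leftDer_leftDer])
    (fun i => by
      rw [← MulOpposite.op_mul, ← MulOpposite.op_zero]
      congr 1
      ext a
      simp [leftDer_leftDer_self])

/-- `leftAct` as a linear map to endomorphisms. -/
def act (A : Matrix (Fin n) (Fin n) k) : EHopf k n →ₗ[k] Module.End k (EHopf k n) :=
  (MulOpposite.opLinearEquiv k).symm.toLinearMap ∘ₗ (leftAct A).toLinearMap

theorem act_one (A : Matrix (Fin n) (Fin n) k) : act A 1 = 1 := by
  simp [act]

theorem act_algebraMap (A : Matrix (Fin n) (Fin n) k) (a : k) :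
    act A (algebraMap k _ a) = a • LinearMap.id := by
  rw [Algebra.algebraMap_eq_smul_one, map_smul, act_one]; rfl

theorem act_mul (A : Matrix (Fin n) (Fin n) k) (a b : EHopf k n) :
    act A (a * b) = act A b * act A a := by
  simp [act]

theorem act_c (A : Matrix (Fin n) (Fin n) k) : act A (c k) = leftSign k n := by
  simp [act, leftAct]

theorem act_x (A : Matrix (Fin n) (Fin n) k) (i : Fin n) : act A (x k i) = leftDer A i := by
  simp [act, leftAct]

/-- The bilinear form on `E(n)` with `c, c ↦ -1` and `xᵢ, xⱼ ↦ a_{ij}` that is multiplicative in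
the sense of universal `r`-forms. -/
def pairing (A : Matrix (Fin n) (Fin n) k) : EHopf k n →ₗ[k] EHopf k n →ₗ[k] k :=
  LinearMap.compRight k (Coalgebra.counit (R := k)) ∘ₗ act A

theorem pairing_apply (A : Matrix (Fin n) (Fin n) k) (a h : EHopf k n) :
    pairing A a h = Coalgebra.counit (R := k) (act A a h) := rfl

theorem act_eq_hitLeft (A : Matrix (Fin n) (Fin n) k) (a : EHopf k n) :
    act A a = hitLeft (pairing A a) := by
  -- The form f need not be tracked: ε recovers it from its operator by `counit_hitLeft`. Operators
  -- of this kind are closed under sums and composition, so generators suffice.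
  suffices ∃ f, act A a = hitLeft f by
    obtain ⟨f, hf⟩ := this
    have : pairing A a = f := by
      ext h
      rw [pairing_apply, hf, counit_hitLeft]
    rw [this, hf]
  induction a using EHopf.induction with
  | hs a =>
    refine ⟨a • Coalgebra.counit (R := k), ?_⟩
    rw [act_algebraMap, ← hitLeft_counit]
    ext h
    simp [hitLeft_apply]
  | hc => exact ⟨_, act_c A⟩
  | hx i => exact ⟨_, act_x A i⟩
  | hm a b ha hb =>
    obtain ⟨f, hf⟩ := ha
    obtain ⟨g, hg⟩ := hb
    exact ⟨_, by rw [act_mul, hf, hg]; exact hitLeft_hitLeft g f⟩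
  | ha a b ha hb =>
    obtain ⟨f, hf⟩ := ha
    obtain ⟨g, hg⟩ := hb
    refine ⟨f + g, ?_⟩
    rw [map_add, hf, hg]
    ext h
    simp [hitLeft_apply, LinearMap.rTensor_add]

theorem pairing_c (A : Matrix (Fin n) (Fin n) k) :
    pairing A (c k) = (signChar k n).toLinearMap := by
  ext h
  rw [pairing_apply, act_c, leftSign, counit_hitLeft]

theorem pairing_x (A : Matrix (Fin n) (Fin n) k) (i : Fin n) :
    pairing A (x k i) = rowForm A i := by
  ext h
  rw [pairing_apply, act_x, leftDer, counit_hitLeft]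

theorem pairing_one_left (A : Matrix (Fin n) (Fin n) k) :
    pairing A 1 = Coalgebra.counit (R := k) := by
  ext h
  rw [pairing_apply, act_one]; rfl

theorem pairing_mul_left_apply (A : Matrix (Fin n) (Fin n) k) (a b h : EHopf k n) :
    pairing A (a * b) h = pairing A b (act A a h) := by
  rw [pairing_apply, act_mul]; rfl

theorem pairing_mul_left (A : Matrix (Fin n) (Fin n) k) (a b : EHopf k n) :
    pairing A (a * b) = convDual (pairing A a) (pairing A b) := by
  ext h
  rw [pairing_mul_left_apply, act_eq_hitLeft, apply_hitLeft]

theorem act_apply_one (A : Matrix (Fin n) (Fin n) k) (a : EHopf k n) :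
    act A a 1 = Coalgebra.counit (R := k) a • 1 := by
  induction a using EHopf.induction with
  | hs a => simp [act_algebraMap]
  | hc => simpa [act_c, counit_c] using leftSign_algebraMap (n := n) (1 : k)
  | hx i => simpa [act_x, counit_x] using leftDer_algebraMap A i 1
  | hm a b ha hb => rw [act_mul, Module.End.mul_apply, ha, map_smul, hb]; simp [mul_smul]
  | ha a b ha hb => simp [ha, hb, add_smul]

theorem pairing_one_right (A : Matrix (Fin n) (Fin n) k) (a : EHopf k n) :
    pairing A a 1 = Coalgebra.counit (R := k) a := by
  rw [pairing_apply, act_apply_one]; simp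

/-! ### Multiplicativity in the second argument -/

/-- The action of `u ⊗ v` on a tensor product of two copies of `E(n)`, by `v` on the left and by
`u` on the right factor. -/
def actTensor (A : Matrix (Fin n) (Fin n) k) :
    EHopf k n ⊗[k] EHopf k n →ₗ[k] Module.End k (EHopf k n ⊗[k] EHopf k n) :=
  TensorProduct.homTensorHomMap (RingHom.id k) _ _ _ _ ∘ₗ TensorProduct.map (act A) (act A) ∘ₗ
    (TensorProduct.comm k _ _).toLinearMap

theorem actTensor_tmul (A : Matrix (Fin n) (Fin n) k) (u v a b : EHopf k n) :
    actTensor A (u ⊗ₜ v) (a ⊗ₜ b) = act A v a ⊗ₜ act A u b := by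
  simp [actTensor]

theorem actTensor_mul (A : Matrix (Fin n) (Fin n) k) (s t : EHopf k n ⊗[k] EHopf k n) :
    actTensor A (s * t) = actTensor A t * actTensor A s := by
  induction s using TensorProduct.induction_on with
  | zero => simp
  | add s s' hs hs' => simp only [add_mul, mul_add, map_add, hs, hs']
  | tmul u v =>
    induction t using TensorProduct.induction_on with
    | zero => simp
    | add t t' ht ht' => simp only [add_mul, mul_add, map_add, ht, ht']
    | tmul p q =>
      ext a b
      simp [actTensor_tmul, act_mul]

/-- In Sweedler notation, a·(pq) = ∑ (a₂·p)(a₁·q). Both sides are antimultiplicative in a, and on c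
and xᵢ the identity is the multiplicativity of `leftSign` and the Leibniz rule of `leftDer`.
Applying ε gives `pairing_mul_right`. -/
theorem act_comp_mul (A : Matrix (Fin n) (Fin n) k) (a : EHopf k n) :
    act A a ∘ₗ LinearMap.mul' k (EHopf k n) =
      LinearMap.mul' k (EHopf k n) ∘ₗ actTensor A (Coalgebra.comul a) := by
  induction a using EHopf.induction with
  | hs a =>
    ext p q
    simp [Algebra.algebraMap_eq_smul_one, act_one, Algebra.TensorProduct.one_def, actTensor_tmul]
  | hc => ext p q; simp [act_c, comul_c, actTensor_tmul, leftSign_mul]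
  | hx i =>
    ext p q
    simp [act_x, act_c, act_one, comul_x, actTensor_tmul, leftDer_mul]
  | hm a b ha hb =>
    rw [Bialgebra.comul_mul, actTensor_mul, act_mul, Module.End.mul_eq_comp, LinearMap.comp_assoc,
      ha, ← LinearMap.comp_assoc, hb, Module.End.mul_eq_comp, LinearMap.comp_assoc]
  | ha a b ha hb => simp only [map_add, LinearMap.add_comp, LinearMap.comp_add, ha, hb]

theorem pairing_mul_right (A : Matrix (Fin n) (Fin n) k) (h a b : EHopf k n) :
    pairing A h (a * b) = LinearMap.mul' k k (TensorProduct.map ((pairing A).flip b)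
      ((pairing A).flip a) (Coalgebra.comul h)) := by
  have h1 := LinearMap.congr_fun (act_comp_mul A h) (a ⊗ₜ b)
  simp only [LinearMap.comp_apply, LinearMap.mul'_apply] at h1
  rw [pairing_apply, h1]
  generalize (Coalgebra.comul h : EHopf k n ⊗[k] EHopf k n) = t
  induction t using TensorProduct.induction_on with
  | zero => simp
  | add s t hs ht => simp only [map_add, LinearMap.add_apply, hs, ht]
  | tmul u v => simp [actTensor_tmul, pairing_apply, mul_comm]

/-! ### The commutation axiom -/

theorem rightSign_eq (b : EHopf k n) : rightSign k n b * c k = c k * leftSign k n b := by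
  induction b using EHopf.induction with
  | hs a => rw [leftSign_algebraMap, rightSign_algebraMap, Algebra.commutes]
  | hc => simp [rightSign_c, leftSign_c]
  | hx i => simp [rightSign_x, leftSign_x, x_mul_c]
  | hm a b ha hb => rw [rightSign_mul, leftSign_mul, mul_assoc, hb, ← mul_assoc, ha, mul_assoc]
  | ha a b ha hb => simp [ha, hb, add_mul, mul_add]

/-- This is the commutation axiom ∑ r(a₁ ⊗ b₁)a₂b₂ = ∑ b₁a₁r(a₂ ⊗ b₂) for a = xᵢ; `rightSign_eq` is
the case a = c. Both sides are skew derivations in b for the same twist, so agreement on generators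
is enough. -/
theorem leftDer_rightDer (A : Matrix (Fin n) (Fin n) k) (i : Fin n) (b : EHopf k n) :
    x k i * b + c k * leftDer A i b = rightDer A i b + rightSign k n b * x k i := by
  induction b using EHopf.induction with
  | hs a =>
    simp [leftDer_algebraMap, rightDer_algebraMap, rightSign_algebraMap, Algebra.commutes]
  | hc => simp [leftDer_c, rightDer_c, rightSign_c, x_mul_c]
  | hx j =>
    simp [leftDer_x, rightDer_x, rightSign_x, c_mul_c]
    rw [x_mul_x_swap]; abel
  | hm a b ha hb =>
    have ha' := congrArg (· * b) ha
    have hb' := congrArg (rightSign k n a * ·) hb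
    simp only [add_mul, mul_add, mul_assoc] at ha' hb'
    rw [leftDer_mul, rightDer_mul, rightSign_mul, mul_add, ← mul_assoc (c k) (leftSign k n a),
      ← rightSign_eq]
    linear_combination (norm := noncomm_ring) ha' + hb'
  | ha a b ha hb =>
    simp only [map_add, mul_add, add_mul]
    rw [add_add_add_comm, ha, hb, add_add_add_comm]

/-- For `u ⊗ v`, the operator `b ↦ ∑ r(u ⊗ b₁) v b₂`. -/
def leftTwist (A : Matrix (Fin n) (Fin n) k) :
    EHopf k n ⊗[k] EHopf k n →ₗ[k] Module.End k (EHopf k n) :=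
  LinearMap.mul' k _ ∘ₗ TensorProduct.map (LinearMap.mul k (EHopf k n)) (act A) ∘ₗ
    (TensorProduct.comm k _ _).toLinearMap

theorem leftTwist_tmul (A : Matrix (Fin n) (Fin n) k) (u v b : EHopf k n) :
    leftTwist A (u ⊗ₜ v) b = v * act A u b := by
  simp [leftTwist]

/-- The operator `h ↦ ∑ h₁ r(a ⊗ h₂)`. -/
def coact (A : Matrix (Fin n) (Fin n) k) : EHopf k n →ₗ[k] Module.End k (EHopf k n) where
  toFun a := hitRight (pairing A a)
  map_add' a b := by ext h; simp [hitRight_apply, LinearMap.lTensor_add]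
  map_smul' r a := by ext h; simp [hitRight_apply, LinearMap.lTensor_smul]

theorem coact_apply (A : Matrix (Fin n) (Fin n) k) (a : EHopf k n) :
    coact A a = hitRight (pairing A a) := rfl

theorem coact_mul (A : Matrix (Fin n) (Fin n) k) (a b : EHopf k n) :
    coact A (a * b) = coact A a * coact A b := by
  rw [coact_apply, pairing_mul_left, ← hitRight_hitRight]; rfl

theorem act_coact (A : Matrix (Fin n) (Fin n) k) (a b h : EHopf k n) :
    act A a (coact A b h) = coact A b (act A a h) := by
  rw [act_eq_hitLeft, coact_apply, hitLeft_hitRight]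

/-- For `u ⊗ v`, the operator `b ↦ ∑ b₁ u r(v ⊗ b₂)`. -/
def rightTwist (A : Matrix (Fin n) (Fin n) k) :
    EHopf k n ⊗[k] EHopf k n →ₗ[k] Module.End k (EHopf k n) :=
  LinearMap.mul' k _ ∘ₗ TensorProduct.map (LinearMap.mul k (EHopf k n)).flip (coact A)

theorem rightTwist_tmul (A : Matrix (Fin n) (Fin n) k) (u v b : EHopf k n) :
    rightTwist A (u ⊗ₜ v) b = coact A v b * u := by
  simp [rightTwist]

/-- The general commutation axiom, propagated from generators to products in a. The left and right
operators commute (`act_coact`), so the two factors can be moved across one at a time. -/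
theorem leftTwist_comul (A : Matrix (Fin n) (Fin n) k) (a b : EHopf k n) :
    leftTwist A (Coalgebra.comul a) b = rightTwist A (Coalgebra.comul a) b := by
  -- In the product case the hypotheses are used at `act A (u i) b` and `coact A (v' j) b`, not at b
  -- itself.
  induction a using EHopf.induction generalizing b with
  | hs a =>
    simp [Algebra.algebraMap_eq_smul_one, act_one, Algebra.TensorProduct.one_def, leftTwist_tmul,
      rightTwist_tmul, coact_apply, pairing_one_left, hitRight_counit]
  | hc =>
    rw [comul_c, leftTwist_tmul, rightTwist_tmul, act_c, coact_apply, pairing_c]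
    exact (rightSign_eq b).symm
  | hx i =>
    simp only [comul_x, map_add, LinearMap.add_apply, leftTwist_tmul, rightTwist_tmul, act_one,
      act_x, coact_apply, pairing_c, pairing_x, Module.End.one_apply, mul_one]
    exact leftDer_rightDer A i b
  | ha a a' h h' => simp only [map_add, LinearMap.add_apply, h, h']
  | hm a a' h h' =>
    rw [Bialgebra.comul_mul]
    obtain ⟨s, u, v, hs⟩ := Coalgebra.Repr.arbitrary k a
    obtain ⟨s', u', v', hs'⟩ := Coalgebra.Repr.arbitrary k a'
    simp only [← hs] at h
    simp only [← hs'] at h'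
    rw [← hs, ← hs']
    simp only [map_sum, LinearMap.sum_apply, leftTwist_tmul, rightTwist_tmul, Finset.sum_mul_sum,
      Algebra.TensorProduct.tmul_mul_tmul, act_mul, coact_mul, Module.End.mul_apply] at h h' ⊢
    calc _ = ∑ i ∈ s, v i * ∑ j ∈ s', v' j * act A (u' j) (act A (u i) b) := by
          simp only [Finset.mul_sum, mul_assoc]
      _ = ∑ j ∈ s', (∑ i ∈ s, v i * act A (u i) (coact A (v' j) b)) * u' j := by
          simp only [h', Finset.mul_sum, Finset.sum_mul, mul_assoc, act_coact]
          exact Finset.sum_comm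
      _ = _ := by
          simp only [h, Finset.sum_mul, mul_assoc]
          exact Finset.sum_comm

/-! ### Universality of the pairing -/

theorem pairing_isUniversalRForm (A : Matrix (Fin n) (Fin n) k) :
    IsUniversalRForm k (TensorProduct.lift (pairing A)) := by
  have hl : ∀ a, TensorProduct.lift (pairing A) ∘ₗ TensorProduct.mk k _ _ a = pairing A a := by
    intro a; ext h; simp
  have hr : ∀ a, TensorProduct.lift (pairing A) ∘ₗ (TensorProduct.mk k _ _).flip a =
      (pairing A).flip a := by
    intro a; ext h; simp
  have conv : ∀ (f g : EHopf k n ⊗[k] EHopf k n →ₗ[k] k) (a b : EHopf k n),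
      (LinearMap.mul' k k ∘ₗ TensorProduct.map f g ∘ₗ Coalgebra.comul) (a ⊗ₜ b) =
      LinearMap.mul' k k (TensorProduct.map f g (TensorProduct.tensorTensorTensorComm k _ _ _ _
        (Coalgebra.comul a ⊗ₜ Coalgebra.comul b))) := by
    intro f g a b
    rfl
  -- Convolving r ∘ (f ⊗ id) with r ∘ (g ⊗ id) gives ∑ r(f(a₁)g(a₂) ⊗ b), by multiplicativity in the
  -- first argument. With f, g the identity and the antipode, in either order, this makes r ∘ (S ⊗
  -- id) the inverse.
  have key : ∀ (f g : EHopf k n →ₗ[k] EHopf k n) (a b : EHopf k n),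
      (LinearMap.mul' k k ∘ₗ TensorProduct.map (TensorProduct.lift (pairing A ∘ₗ f))
        (TensorProduct.lift (pairing A ∘ₗ g)) ∘ₗ Coalgebra.comul) (a ⊗ₜ b) =
      pairing A (LinearMap.mul' k _ (TensorProduct.map f g (Coalgebra.comul a))) b := by
    intro f g a b
    rw [conv]
    generalize (Coalgebra.comul a : EHopf k n ⊗[k] EHopf k n) = s
    induction s using TensorProduct.induction_on with
    | zero => simp
    | add s s' hs hs' =>
      simp only [map_add, TensorProduct.add_tmul, LinearMap.add_apply, hs, hs']
    | tmul u v =>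
      rw [TensorProduct.map_tmul, LinearMap.mul'_apply, pairing_mul_left, convDual_apply]
      generalize (Coalgebra.comul b : EHopf k n ⊗[k] EHopf k n) = t
      induction t using TensorProduct.induction_on with
      | zero => simp
      | add t t' ht ht' => simp only [map_add, TensorProduct.tmul_add, ht, ht']
      | tmul p q => simp
  have counit' : ∀ a b : EHopf k n, Coalgebra.counit (R := k) (a ⊗ₜ[k] b) =
      Coalgebra.counit (R := k) a * Coalgebra.counit (R := k) b := by
    intro a b
    simp [mul_comm]
  have hs : ∀ (a : k) (b : EHopf k n), pairing A (algebraMap k _ a) b =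
      a * Coalgebra.counit (R := k) b := by
    intro a b
    simp [pairing_apply, act_algebraMap]
  refine ⟨?_, ?_, ?_, ?_, ?_, ⟨TensorProduct.lift (pairing A ∘ₗ antipodeLin k n), ?_, ?_⟩⟩
  · intro a b h
    rw [hl, hl, ← convDual_apply, ← pairing_mul_left]
    simp
  · intro h
    simp [pairing_one_left]
  · intro h a b
    rw [hr, hr, ← pairing_mul_right]
    simp
  · intro h
    simp [pairing_one_right]
  · intro a b
    have h1 : ∀ s : EHopf k n ⊗[k] EHopf k n,
        TensorProduct.lid k _ (TensorProduct.map (TensorProduct.lift (pairing A))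
          (LinearMap.mul' k _) (TensorProduct.tensorTensorTensorComm k _ _ _ _
            (s ⊗ₜ Coalgebra.comul b))) = leftTwist A s b := by
      intro s
      induction s using TensorProduct.induction_on with
      | zero => simp
      | add s s' hs hs' =>
        simp only [map_add, TensorProduct.add_tmul, LinearMap.add_apply, hs, hs']
      | tmul u v =>
        rw [leftTwist_tmul, act_eq_hitLeft, hitLeft_apply]
        generalize (Coalgebra.comul b : EHopf k n ⊗[k] EHopf k n) = t
        induction t using TensorProduct.induction_on with
        | zero => simp
        | add t t' ht ht' => simp only [map_add, mul_add, TensorProduct.tmul_add, ht, ht']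
        | tmul p q => simp
    have h2 : ∀ s : EHopf k n ⊗[k] EHopf k n,
        TensorProduct.rid k _ (TensorProduct.map
          (LinearMap.mul' k _ ∘ₗ (TensorProduct.comm k _ _).toLinearMap)
          (TensorProduct.lift (pairing A)) (TensorProduct.tensorTensorTensorComm k _ _ _ _
            (s ⊗ₜ Coalgebra.comul b))) = rightTwist A s b := by
      intro s
      induction s using TensorProduct.induction_on with
      | zero => simp
      | add s s' hs hs' =>
        simp only [map_add, TensorProduct.add_tmul, LinearMap.add_apply, hs, hs']
      | tmul u v =>
        rw [rightTwist_tmul, coact_apply, hitRight_apply]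
        generalize (Coalgebra.comul b : EHopf k n ⊗[k] EHopf k n) = t
        induction t using TensorProduct.induction_on with
        | zero => simp
        | add t t' ht ht' => simp only [map_add, add_mul, TensorProduct.tmul_add, ht, ht']
        | tmul p q => simp
    exact (h1 _).trans ((leftTwist_comul A a b).trans (h2 _).symm)
  · refine TensorProduct.ext' fun a b => ?_
    have h := key LinearMap.id (antipodeLin k n) a b
    rw [LinearMap.comp_id] at h
    rw [h, counit']
    exact (congrArg (pairing A · b) (antipode_right k a)).trans (hs _ _)
  · refine TensorProduct.ext' fun a b => ?_
    have h := key (antipodeLin k n) LinearMap.id a b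
    rw [LinearMap.comp_id] at h
    rw [h, counit']
    exact (congrArg (pairing A · b) (antipode_left k a)).trans (hs _ _)

/-! ### Values of the pairing on monomials -/

variable (k) in
/-- The product of the `x_{f(i)}` in order. -/
def xWord {m : ℕ} (f : Fin m → Fin n) : EHopf k n := (List.ofFn fun i => x k (f i)).prod

theorem xWord_zero (f : Fin 0 → Fin n) : xWord k f = 1 := by
  simp [xWord]

theorem xWord_succ {m : ℕ} (f : Fin (m + 1) → Fin n) :
    xWord k f = x k (f 0) * xWord k (f ∘ Fin.succ) := by
  simp [xWord, List.ofFn_succ]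

theorem xProd_eq_xWord (P : Finset (Fin n)) {m : ℕ} (h : P.card = m) :
    xProd k P = xWord k (P.orderEmbOfFin h) := by
  rw [xProd, xWord]
  congr 1
  apply List.ext_getElem
  · simp [h]
  · intro i h1 h2
    simp [Finset.orderEmbOfFin_apply]

theorem leftSign_xWord {m : ℕ} (f : Fin m → Fin n) : leftSign k n (xWord k f) = xWord k f := by
  induction m with
  | zero => simpa [xWord_zero] using leftSign_algebraMap (n := n) (1 : k)
  | succ m ih => rw [xWord_succ, leftSign_mul, ih, leftSign_x]

theorem leftDer_xWord_zero (A : Matrix (Fin n) (Fin n) k) (i : Fin n) (f : Fin 0 → Fin n) :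
    leftDer A i (xWord k f) = 0 := by
  simpa [xWord_zero] using leftDer_algebraMap A i 1

/-- The derivation replaces one letter x_{f(j)} by a multiple of c, and moving c to the front past j
letters costs (-1)^j. These are the signs of a Laplace expansion. -/
theorem leftDer_xWord (A : Matrix (Fin n) (Fin n) k) (i : Fin n) {m : ℕ}
    (f : Fin (m + 1) → Fin n) : leftDer A i (xWord k f) =
      ∑ j : Fin (m + 1), ((-1) ^ (j : ℕ) * A i (f j)) • (c k * xWord k (f ∘ j.succAbove)) := by
  induction m with
  | zero =>
    simp [xWord_succ, xWord_zero, leftDer_x]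
  | succ m ih =>
    rw [xWord_succ, leftDer_mul, ih, leftDer_x, leftSign_x, Finset.mul_sum]
    conv_rhs => rw [Fin.sum_univ_succ]
    congr 1
    · simp [Function.comp_def]
    · refine Finset.sum_congr rfl fun j _ => ?_
      have h : (f ∘ j.succ.succAbove) ∘ Fin.succ = (f ∘ Fin.succ) ∘ j.succAbove := by
        ext l; simp
      rw [xWord_succ (f ∘ j.succ.succAbove), h]
      simp [← mul_assoc, x_mul_c, pow_succ]

theorem leftDer_c_mul (A : Matrix (Fin n) (Fin n) k) (i : Fin n) (a : EHopf k n) :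
    leftDer A i (c k * a) = -(c k * leftDer A i a) := by
  simp [leftDer_mul, leftDer_c, leftSign_c]

theorem pairing_x_mul (A : Matrix (Fin n) (Fin n) k) (i : Fin n) (a h : EHopf k n) :
    pairing A (x k i * a) h = pairing A a (leftDer A i h) := by
  rw [pairing_mul_left_apply, act_x]

theorem pairing_c_mul (A : Matrix (Fin n) (Fin n) k) (a h : EHopf k n) :
    pairing A (c k * a) h = pairing A a (leftSign k n h) := by
  rw [pairing_mul_left_apply, act_c]

theorem pairing_xWord_c_mul (A : Matrix (Fin n) (Fin n) k) {m : ℕ} (f : Fin m → Fin n)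
    (h : EHopf k n) : pairing A (xWord k f) (c k * h) = (-1) ^ m * pairing A (xWord k f) h := by
  induction m generalizing h with
  | zero => simp [xWord_zero, pairing_one_left, Bialgebra.counit_mul, counit_c]
  | succ m ih =>
    rw [xWord_succ, pairing_x_mul, pairing_x_mul, leftDer_c_mul, map_neg, ih, pow_succ]
    ring

theorem pairing_xWord_xWord_of_ne (A : Matrix (Fin n) (Fin n) k) {m l : ℕ} (f : Fin m → Fin n)
    (g : Fin l → Fin n) (h : l ≠ m) : pairing A (xWord k f) (xWord k g) = 0 := by
  induction m generalizing l with
  | zero =>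
    obtain ⟨l, rfl⟩ := Nat.exists_eq_succ_of_ne_zero h
    rw [xWord_zero, pairing_one_left, xWord_succ, Bialgebra.counit_mul, counit_x, zero_mul]
  | succ m ih =>
    rw [xWord_succ, pairing_x_mul]
    cases l with
    | zero => rw [leftDer_xWord_zero, map_zero]
    | succ l =>
      rw [leftDer_xWord, map_sum]
      refine Finset.sum_eq_zero fun j _ => ?_
      rw [map_smul, pairing_xWord_c_mul, ih _ _ (by omega)]
      simp

/-- Peeling off the first letter on the left expands the determinant along its first row. The c left
behind by `leftDer` contributes (-1)^m for the m remaining letters, and these signs accumulate to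
m(m-1)/2. -/
theorem pairing_xWord_xWord (A : Matrix (Fin n) (Fin n) k) {m : ℕ} (f g : Fin m → Fin n) :
    pairing A (xWord k f) (xWord k g) = (-1) ^ (m * (m - 1) / 2) * (A.submatrix f g).det := by
  induction m with
  | zero => simp [xWord_zero, pairing_one_left]
  | succ m ih =>
    have h2 : (m + 1) * (m + 1 - 1) / 2 = m + m * (m - 1) / 2 := by
      rw [← Finset.sum_range_id_mul_two (m + 1), ← Finset.sum_range_id_mul_two m,
        Nat.mul_div_cancel _ two_pos, Nat.mul_div_cancel _ two_pos, Finset.sum_range_succ, add_comm]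
    rw [xWord_succ, pairing_x_mul, leftDer_xWord, map_sum, Matrix.det_succ_row_zero, h2,
      Finset.mul_sum]
    refine Finset.sum_congr rfl fun j _ => ?_
    rw [map_smul, pairing_xWord_c_mul, ih, Matrix.submatrix_submatrix, Matrix.submatrix_apply,
      pow_add, smul_eq_mul]
    ring

/-- The sign by which the pairing of `c^a x_P` and `c^b x_F` differs from that of `x_P` and `x_F`,
where `m = |P|`. -/
def monSign (k : Type*) [Field k] (m : ℕ) : Bool → Bool → k
  | false, false => 1
  | true, false => 1
  | false, true => (-1) ^ m
  | true, true => -(-1) ^ m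

theorem pairing_mon (A : Matrix (Fin n) (Fin n) k) (a b : Bool) (P F : Finset (Fin n)) :
    pairing A (mon k (a, P)) (mon k (b, F)) =
      monSign k P.card a b * pairing A (xProd k P) (xProd k F) := by
  cases a <;> cases b <;>
    simp [mon, monSign, xProd_eq_xWord _ rfl, pairing_c_mul, leftSign_mul, leftSign_c,
      leftSign_xWord, pairing_xWord_c_mul]

theorem rForm_eq (A : Matrix (Fin n) (Fin n) k) : rForm A = TensorProduct.lift (pairing A) := by
  have hx : ∀ P p, xDual k P (mon k (n := n) p) = if p = (false, P) then 1 else 0 := by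
    intro P p
    rw [xDual, ← monBasis_apply, Module.Basis.coord_apply, Module.Basis.repr_self,
      Finsupp.single_apply]
  have hcx : ∀ P p, cxDual k P (mon k (n := n) p) = if p = (true, P) then 1 else 0 := by
    intro P p
    rw [cxDual, ← monBasis_apply, Module.Basis.coord_apply, Module.Basis.repr_self,
      Finsupp.single_apply]
  refine ((monBasis k n).tensorProduct (monBasis k n)).ext fun ⟨⟨a, P⟩, ⟨b, F⟩⟩ => ?_
  rw [Module.Basis.tensorProduct_apply, monBasis_apply, monBasis_apply, TensorProduct.lift.tmul,
    pairing_mon]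
  -- The four-term bracket is the indicator of the pair (P, F) weighted by `monSign`, so the double
  -- sum over subsets collapses to one term.
  have hval : ∀ P' F' : Finset (Fin n),
      (dualTmul (xDual k P') (xDual k F') + dualTmul (cxDual k P') (xDual k F') +
          (-1 : k) ^ P'.card • dualTmul (xDual k P') (cxDual k F') -
          (-1 : k) ^ P'.card • dualTmul (cxDual k P') (cxDual k F'))
        (mon k (a, P) ⊗ₜ mon k (b, F)) = if P' = P ∧ F' = F then monSign k P.card a b else 0 := by
    intro P' F'
    by_cases hP : P' = P
    · subst hP
      by_cases hF : F' = F
      · subst hF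
        cases a <;> cases b <;> simp [dualTmul_tmul, hx, hcx, monSign]
      · simp [dualTmul_tmul, hx, hcx, hF, Ne.symm hF]
    · simp [dualTmul_tmul, hx, hcx, hP, Ne.symm hP]
  simp only [rForm, LinearMap.sum_apply, LinearMap.smul_apply, hval]
  rw [Finset.sum_eq_single P (fun P' _ h => by simp [h]) (by simp)]
  by_cases hc : F.card = P.card
  · rw [Finset.sum_eq_single ⟨F, hc⟩
      (fun F' _ h => by simp [show F'.1 ≠ F from fun h' => h (Subtype.ext h')]) (by simp)]
    -- Transposing is needed because the Leibniz formula `Matrix.det_apply'` permutes row indices,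
    -- whereas r_A permutes the column indices f_η(i).
    rw [xProd_eq_xWord P rfl, xProd_eq_xWord F hc, pairing_xWord_xWord, ← Matrix.det_transpose,
      Matrix.det_apply']
    simp only [and_self, if_true, smul_eq_mul, Finset.mul_sum, Matrix.transpose_apply,
      Matrix.submatrix_apply]
    refine Finset.sum_congr rfl fun η _ => ?_
    ring
  · rw [xProd_eq_xWord P rfl, xProd_eq_xWord F rfl, pairing_xWord_xWord_of_ne _ _ _ hc]
    rw [Finset.sum_eq_zero (fun F' _ => by
      simp [show F'.1 ≠ F from fun h' => hc (h' ▸ F'.2)])]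
    simp

/-! ### The inverse of the antipode -/

theorem antipodeLin_algebraMap (a : k) :
    antipodeLin k n (algebraMap k _ a) = algebraMap k _ a := by
  simp [Algebra.algebraMap_eq_smul_one, antipodeLin_one]

variable (k n) in
/-- The inverse of the antipode. -/
def antipodeInv : EHopf k n →ₗ[k] EHopf k n :=
  antipodeLin k n ∘ₗ antipodeLin k n ∘ₗ antipodeLin k n

/-- S² fixes c and sends xᵢ to -xᵢ, so S⁴ = id and S³ is the inverse. -/
theorem antipodeInv_antipodeLin (a : EHopf k n) : antipodeInv k n (antipodeLin k n a) = a := by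
  induction a using EHopf.induction with
  | hs a => simp [antipodeInv, antipodeLin_algebraMap]
  | hc => simp [antipodeInv, antipodeLin_c]
  | hx i =>
    have h : antipodeLin k n (c k * x k i) = -x k i := by
      rw [antipodeLin_mul, antipodeLin_c, antipodeLin_x, mul_assoc, x_mul_c, mul_neg, ← mul_assoc,
        c_mul_c, one_mul]
    simp [antipodeInv, antipodeLin_x, h]
  | hm a b ha hb =>
    simp only [antipodeInv, LinearMap.comp_apply] at ha hb
    simp only [antipodeInv, LinearMap.comp_apply, antipodeLin_mul, ha, hb]
  | ha a b ha hb => simp only [map_add, ha, hb]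

theorem antipodeLin_antipodeInv (a : EHopf k n) : antipodeLin k n (antipodeInv k n a) = a :=
  antipodeInv_antipodeLin a

theorem antipodeInv_algebraMap (a : k) :
    antipodeInv k n (algebraMap k _ a) = algebraMap k _ a := by
  simp [antipodeInv, antipodeLin_algebraMap]

/-- Apply the product-reversing map S⁻¹ to ∑ S(a₁)a₂ = ε(a). -/
theorem antipodeInv_left (a : EHopf k n) :
    LinearMap.mul' k _ (TensorProduct.map (antipodeInv k n) LinearMap.id
      (TensorProduct.comm k _ _ (Coalgebra.comul a))) =
      algebraMap k _ (Coalgebra.counit (R := k) a) := by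
  have h : ∀ t : EHopf k n ⊗[k] EHopf k n, LinearMap.mul' k _ (TensorProduct.map
      (antipodeInv k n) LinearMap.id (TensorProduct.comm k _ _ t)) =
      antipodeInv k n (LinearMap.mul' k _ ((antipodeLin k n).rTensor _ t)) := by
    intro t
    induction t using TensorProduct.induction_on with
    | zero => simp
    | add s t hs ht => simp only [map_add, hs, ht]
    | tmul u v =>
      rw [← antipodeInv_antipodeLin (LinearMap.mul' k _ _)]
      simp [antipodeLin_mul, antipodeLin_antipodeInv]
  rw [h, antipode_left, antipodeInv_algebraMap]

theorem antipodeInv_right (a : EHopf k n) :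
    LinearMap.mul' k _ (TensorProduct.map LinearMap.id (antipodeInv k n)
      (TensorProduct.comm k _ _ (Coalgebra.comul a))) =
      algebraMap k _ (Coalgebra.counit (R := k) a) := by
  have h : ∀ t : EHopf k n ⊗[k] EHopf k n, LinearMap.mul' k _ (TensorProduct.map
      LinearMap.id (antipodeInv k n) (TensorProduct.comm k _ _ t)) =
      antipodeInv k n (LinearMap.mul' k _ ((antipodeLin k n).lTensor _ t)) := by
    intro t
    induction t using TensorProduct.induction_on with
    | zero => simp
    | add s t hs ht => simp only [map_add, hs, ht]
    | tmul u v =>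
      rw [← antipodeInv_antipodeLin (LinearMap.mul' k _ _)]
      simp [antipodeLin_mul, antipodeLin_antipodeInv]
  rw [h, antipode_right, antipodeInv_algebraMap]

/-! ### The canonical maps in terms of the pairing -/

-- Multiplication in the opposite algebra yields ∑ d₁a₁r(a₂ ⊗ d₂). The commutation axiom turns it
-- into ∑ r(a₁ ⊗ d₁)a₂d₂, where a₂ stands on the left and can be cancelled by the antipode's
-- inverse.
open MulOpposite in
theorem azumayaG_op (A : Matrix (Fin n) (Fin n) k) (a b d : EHopf k n) :
    azumayaG (TensorProduct.lift (pairing A)) (opComoduleAlgebra k (EHopf k n))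
      (op a ⊗ₜ op b) (op d) = op (b * leftTwist A (Coalgebra.comul a) d) := by
  rw [azumayaG_apply, leftTwist_comul, op_mul]
  congr 1
  have h : ∀ s : EHopf k n ⊗[k] EHopf k n,
      pairMul (TensorProduct.lift (pairing A))
        ((opLinearEquiv k).toLinearMap.rTensor _ s ⊗ₜ
          (opLinearEquiv k).toLinearMap.rTensor _ (Coalgebra.comul d)) =
      op (rightTwist A s d) := by
    intro s
    induction s using TensorProduct.induction_on with
    | zero => simp
    | add s s' hs hs' =>
      simp only [map_add, TensorProduct.add_tmul, LinearMap.add_apply, hs, hs', op_add]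
    | tmul u v =>
      rw [rightTwist_tmul, coact_apply, hitRight_apply]
      generalize (Coalgebra.comul d : EHopf k n ⊗[k] EHopf k n) = t
      induction t using TensorProduct.induction_on with
      | zero => simp
      | add t t' ht ht' =>
        simp only [map_add, add_mul, TensorProduct.tmul_add, ht, ht', op_add]
      | tmul p q => simp [pairMul_tmul]
  exact h _

open MulOpposite in
theorem azumayaF_op (A : Matrix (Fin n) (Fin n) k) (a b d : EHopf k n) :
    azumayaF (TensorProduct.lift (pairing A)) (opComoduleAlgebra k (EHopf k n))
      (op a ⊗ₜ op b) (op d) = op (leftTwist A (Coalgebra.comul d) b * a) := by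
  rw [azumayaF_apply, leftTwist_comul, op_mul]
  congr 1
  have h : ∀ s : EHopf k n ⊗[k] EHopf k n,
      pairMul (TensorProduct.lift (pairing A))
        ((opLinearEquiv k).toLinearMap.rTensor _ s ⊗ₜ
          (opLinearEquiv k).toLinearMap.rTensor _ (Coalgebra.comul b)) =
      op (rightTwist A s b) := by
    intro s
    induction s using TensorProduct.induction_on with
    | zero => simp
    | add s s' hs hs' =>
      simp only [map_add, TensorProduct.add_tmul, LinearMap.add_apply, hs, hs', op_add]
    | tmul u v =>
      rw [rightTwist_tmul, coact_apply, hitRight_apply]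
      generalize (Coalgebra.comul b : EHopf k n ⊗[k] EHopf k n) = t
      induction t using TensorProduct.induction_on with
      | zero => simp
      | add t t' ht ht' =>
        simp only [map_add, add_mul, TensorProduct.tmul_add, ht, ht', op_add]
      | tmul p q => simp [pairMul_tmul]
  exact h _

/-- A singular matrix gives a map `G` that is not injective. -/
theorem det_ne_zero_of_injective (A : Matrix (Fin n) (Fin n) k)
    (hG : Function.Injective (azumayaG (TensorProduct.lift (pairing A))
      (opComoduleAlgebra k (EHopf k n)))) : A.det ≠ 0 := by
  intro hA
  obtain ⟨v, hv, hvA⟩ := Matrix.exists_vecMul_eq_zero_iff.2 hA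
  refine hv (funext fun i => ?_)
  set y : EHopf k n := ∑ j, v j • x k j with hy
  have hcomul : Coalgebra.comul (R := k) y = 1 ⊗ₜ y + y ⊗ₜ c k := by
    simp [hy, comul_x, Finset.sum_add_distrib, TensorProduct.tmul_sum, TensorProduct.sum_tmul,
      TensorProduct.smul_tmul']
  have hform : pairing A y = 0 := by
    have key : ∀ h, ∑ j, v j * rowForm A j h = 0 := by
      intro h
      induction h using EHopf.induction with
      | hs a => simp [Algebra.algebraMap_eq_smul_one, rowForm_one]
      | hc => simp [rowForm_c]
      | hx i => simpa [rowForm_x, Matrix.vecMul, dotProduct] using congrFun hvA i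
      | hm a b ha hb =>
        simp only [rowForm_mul, mul_add, Finset.sum_add_distrib, ← mul_assoc, ← Finset.sum_mul, ha]
        simp only [mul_comm _ (signChar k n a), mul_assoc, ← Finset.mul_sum, hb]
        simp
      | ha a b ha hb => simp only [map_add, mul_add, Finset.sum_add_distrib, ha, hb, add_zero]
    ext h
    simpa [hy, pairing_x] using key h
  have hact : act A y = 0 := by
    rw [act_eq_hitLeft, hform, hitLeft_zero]
  -- Since y acts by zero, only the summand 1 ⊗ y of Δ(y) contributes to G(y ⊗ 1), so both tensors
  -- give d ↦ yd.
  have h : MulOpposite.op y ⊗ₜ[k] MulOpposite.op (1 : EHopf k n) =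
      MulOpposite.op 1 ⊗ₜ MulOpposite.op y := by
    apply hG
    ext d
    obtain ⟨d, rfl⟩ := MulOpposite.op_surjective d
    rw [azumayaG_op, azumayaG_op, hcomul]
    simp [leftTwist_tmul, act_one, hact, Algebra.TensorProduct.one_def]
  -- With the identity matrix, `rowForm` reads off the coefficient of xᵢ. Tensored with ε it yields
  -- vᵢ on y ⊗ 1 and 0 on 1 ⊗ y.
  have h' := congrArg (LinearMap.mul' k k ∘ₗ TensorProduct.map
    (rowForm 1 i ∘ₗ (MulOpposite.opLinearEquiv k).symm.toLinearMap)
    (Coalgebra.counit (R := k) ∘ₗ (MulOpposite.opLinearEquiv k).symm.toLinearMap)) h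
  simpa [rowForm_one, hy, rowForm_x, Matrix.one_apply, counit_x] using h'

/-! ### Nondegeneracy of the pairing -/

theorem x_mul_prod_eq_zero {l : List (Fin n)} {i : Fin n} (h : i ∈ l) :
    x k i * (l.map (x k)).prod = 0 := by
  induction l with
  | nil => simp at h
  | cons j l ih =>
    rw [List.map_cons, List.prod_cons, ← mul_assoc]
    rcases List.mem_cons.1 h with rfl | h
    · rw [x_mul_x, zero_mul]
    · rw [x_mul_x_swap, neg_mul, mul_assoc, ih h, mul_zero, neg_zero]

theorem prod_eq_zero_of_not_nodup {l : List (Fin n)} (h : ¬l.Nodup) :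
    (l.map (x k)).prod = 0 := by
  induction l with
  | nil => simp at h
  | cons j l ih =>
    rw [List.map_cons, List.prod_cons]
    by_cases hj : j ∈ l
    · exact x_mul_prod_eq_zero hj
    · rw [ih (fun hl => h (List.nodup_cons.2 ⟨hj, hl⟩)), mul_zero]

/-- The generators anticommute, so reordering changes only a sign; later only its being nonzero
matters. -/
theorem prod_perm {l l' : List (Fin n)} (h : l.Perm l') :
    ∃ s : k, s ≠ 0 ∧ (l.map (x k)).prod = s • (l'.map (x k)).prod := by
  induction h with
  | nil => exact ⟨1, one_ne_zero, by simp⟩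
  | cons i _ ih =>
    obtain ⟨s, hs, h⟩ := ih
    exact ⟨s, hs, by simp [h]⟩
  | swap i j l =>
    refine ⟨-1, by simp, ?_⟩
    simp only [List.map_cons, List.prod_cons, ← mul_assoc]
    rw [x_mul_x_swap]
    simp
  | trans _ _ ih ih' =>
    obtain ⟨s, hs, h⟩ := ih
    obtain ⟨s', hs', h'⟩ := ih'
    exact ⟨s * s', mul_ne_zero hs hs', by rw [h, h', smul_smul]⟩

theorem xProd_mul_xProd_of_not_disjoint {P Q : Finset (Fin n)} (h : ¬Disjoint P Q) :
    xProd k P * xProd k Q = 0 := by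
  rw [xProd, xProd, ← List.prod_append, ← List.map_append]
  refine prod_eq_zero_of_not_nodup fun hn => h ?_
  rw [List.nodup_append'] at hn
  rw [Finset.disjoint_left]
  intro i hi hi'
  exact hn.2.2 (by simpa using hi) (by simpa using hi')

theorem xProd_mul_xProd_compl (P : Finset (Fin n)) :
    ∃ s : k, s ≠ 0 ∧ xProd k P * xProd k Pᶜ = s • xProd k Finset.univ := by
  rw [xProd, xProd, xProd, ← List.prod_append, ← List.map_append]
  refine prod_perm ?_
  rw [List.perm_ext_iff_of_nodup]
  · intro i
    simp [em]
  · rw [List.nodup_append']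
    refine ⟨Finset.sort_nodup _ _, Finset.sort_nodup _ _, fun i hi hi' => ?_⟩
    simp at hi hi'
    exact hi' hi
  · exact Finset.sort_nodup _ _

/-- Take P of least size among the subsets with x_P or cx_P in the support of a, and let y = x_{Pᶜ}.
A monomial indexed by Q ≠ P is killed when Q meets Pᶜ; otherwise Q is a proper subset of P and has
zero coefficient by minimality. -/
theorem exists_mul_eq_top {a : EHopf k n} (ha : a ≠ 0) :
    ∃ (y : EHopf k n) (α β : k), (α ≠ 0 ∨ β ≠ 0) ∧
      a * y = α • xProd k Finset.univ + β • (c k * xProd k Finset.univ) := by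
  classical
  set S : Finset (Finset (Fin n)) := Finset.univ.filter fun P =>
    (monBasis k n).repr a (false, P) ≠ 0 ∨ (monBasis k n).repr a (true, P) ≠ 0 with hS
  have hne : S.Nonempty := by
    by_contra h
    rw [Finset.not_nonempty_iff_eq_empty] at h
    refine ha ((monBasis k n).ext_elem fun ⟨b, P⟩ => ?_)
    have hP : P ∉ S := by simp [h]
    simp only [hS, Finset.mem_filter, Finset.mem_univ, true_and, not_or, not_not] at hP
    cases b <;> simp [hP]
  obtain ⟨P, hPS, hmin⟩ := S.exists_min_image Finset.card hne
  obtain ⟨s, hs, hPc⟩ := xProd_mul_xProd_compl (k := k) P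
  refine ⟨xProd k Pᶜ, (monBasis k n).repr a (false, P) * s, (monBasis k n).repr a (true, P) * s,
    ?_, ?_⟩
  · simpa [hs, hS] using hPS
  have hzero : ∀ Q, Q ≠ P → ∀ b,
      (monBasis k n).repr a (b, Q) • (mon k (b, Q) * xProd k Pᶜ) = 0 := by
    intro Q hQ b
    by_cases hd : Disjoint Q Pᶜ
    · have hQP : Q ⊆ P := disjoint_compl_right_iff.1 hd
      have hQS : Q ∉ S := fun h => hQ (Finset.eq_of_subset_of_card_le hQP (hmin Q h))
      simp only [hS, Finset.mem_filter, Finset.mem_univ, true_and, not_or, not_not] at hQS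
      cases b <;> simp [hQS]
    · simp [mon, mul_assoc, xProd_mul_xProd_of_not_disjoint hd]
  have hsum : ∀ b, ∑ Q, (monBasis k n).repr a (b, Q) • (mon k (b, Q) * xProd k Pᶜ) =
      (monBasis k n).repr a (b, P) • (mon k (b, P) * xProd k Pᶜ) :=
    fun b => Finset.sum_eq_single P (fun Q _ hQ => hzero Q hQ b) (by simp)
  conv_lhs => rw [← (monBasis k n).sum_repr a]
  rw [Finset.sum_mul, Fintype.sum_prod_type, Fintype.sum_bool]
  simp only [monBasis_apply, smul_mul_assoc, hsum]
  simp [mon, mul_assoc, hPc, smul_smul, add_comm]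

theorem xProd_univ : xProd k (Finset.univ : Finset (Fin n)) = xWord k id := by
  rw [xProd_eq_xWord _ (Finset.card_fin n)]
  congr 1
  exact (Finset.orderEmbOfFin_unique (Finset.card_fin n) (fun _ => Finset.mem_univ _)
    strictMono_id).symm

/-- The kernel is a right ideal, so `exists_mul_eq_top` reduces the claim to the span of x_top and
cx_top. On it the Gram matrix is t times an invertible sign matrix of determinant ±2, with t = ±det
A. -/
theorem pairing_injective (hk : ringChar k ≠ 2) (A : Matrix (Fin n) (Fin n) k) (hA : A.det ≠ 0) :
    Function.Injective (pairing A) := by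
  rw [injective_iff_map_eq_zero]
  intro a ha
  by_contra hne
  obtain ⟨y, α, β, hαβ, hy⟩ := exists_mul_eq_top hne
  have h2 : (2 : k) ≠ 0 := Ring.two_ne_zero hk
  have h0 : pairing A (a * y) = 0 := by
    ext h
    rw [pairing_mul_left_apply, act_eq_hitLeft, ha, hitLeft_zero]
    simp
  set t := pairing A (xProd k Finset.univ) (xProd k Finset.univ) with ht
  have ht0 : t ≠ 0 := by
    rw [ht, xProd_univ, pairing_xWord_xWord]
    simpa using hA
  have e := fun b => LinearMap.congr_fun h0 (mon k (b, Finset.univ))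
  have m0 : xProd k (Finset.univ : Finset (Fin n)) = mon k (false, Finset.univ) := by simp [mon]
  have m1 : c k * xProd k (Finset.univ : Finset (Fin n)) = mon k (true, Finset.univ) := by
    simp [mon]
  rw [hy, m1, m0] at e
  simp only [map_add, map_smul, LinearMap.add_apply, LinearMap.smul_apply, pairing_mon, ← ht,
    LinearMap.zero_apply, smul_eq_mul] at e
  have e0 := e false
  have e1 := e true
  simp only [monSign] at e0 e1
  have hu : ((-1 : k) ^ (Finset.univ : Finset (Fin n)).card) ≠ 0 := by simp
  have f0 : α + β = 0 := by
    refine (mul_eq_zero.1 (?_ : (α + β) * t = 0)).resolve_right ht0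
    linear_combination e0
  have f1 : α - β = 0 := by
    refine (mul_eq_zero.1 (?_ : (α - β) *
      ((-1 : k) ^ (Finset.univ : Finset (Fin n)).card * t) = 0)).resolve_right
        (mul_ne_zero hu ht0)
    linear_combination e1
  have g0 : α = 0 := (mul_eq_zero.1 (by linear_combination f0 + f1 : 2 * α = 0)).resolve_left h2
  have g1 : β = 0 := (mul_eq_zero.1 (by linear_combination f0 - f1 : 2 * β = 0)).resolve_left h2
  rcases hαβ with h | h
  · exact h g0
  · exact h g1

/-! ### Surjectivity of the canonical maps -/

/-- `∑ g(h₁) S(h₂) h₃ = g(h)`. -/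
theorem conv_antipode_conv_id (g : Module.End k (EHopf k n)) (h : EHopf k n) :
    LinearMap.mul' k _ (TensorProduct.map (LinearMap.mul' k _ ∘ₗ
      TensorProduct.map g (antipodeLin k n) ∘ₗ Coalgebra.comul) LinearMap.id
        (Coalgebra.comul h)) = g h := by
  have h1 : ∀ t : EHopf k n ⊗[k] EHopf k n, LinearMap.mul' k _ (TensorProduct.map
      (LinearMap.mul' k _ ∘ₗ TensorProduct.map g (antipodeLin k n) ∘ₗ Coalgebra.comul)
        LinearMap.id t) = LinearMap.mul' k _ (TensorProduct.map g (LinearMap.mul' k _ ∘ₗ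
          (antipodeLin k n).rTensor _) (TensorProduct.assoc k _ _ _
            ((Coalgebra.comul (R := k)).rTensor _ t))) := by
    intro t
    induction t using TensorProduct.induction_on with
    | zero => simp
    | add s t hs ht => simp only [map_add, hs, ht]
    | tmul u v =>
      simp only [TensorProduct.map_tmul, LinearMap.rTensor_tmul, LinearMap.comp_apply]
      generalize (Coalgebra.comul u : EHopf k n ⊗[k] EHopf k n) = s
      induction s using TensorProduct.induction_on with
      | zero => simp
      | add s t hs ht => simp only [map_add, TensorProduct.add_tmul, hs, ht]
      | tmul p q => simp [mul_assoc]
  have h2 : ∀ t : EHopf k n ⊗[k] EHopf k n, LinearMap.mul' k _ (TensorProduct.map g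
      (LinearMap.mul' k _ ∘ₗ (antipodeLin k n).rTensor _)
        ((Coalgebra.comul (R := k)).lTensor _ t)) = g (TensorProduct.rid k _
          ((Coalgebra.counit (R := k)).lTensor _ t)) := by
    intro t
    induction t using TensorProduct.induction_on with
    | zero => simp
    | add s t hs ht => simp only [map_add, hs, ht]
    | tmul u v =>
      simp [antipode_left, Algebra.algebraMap_eq_smul_one]
  rw [h1, Coalgebra.coassoc_apply, h2, Coalgebra.lTensor_counit_comul]
  simp

/-- `∑ h₃ S⁻¹(h₂) g(h₁) = g(h)`. -/
theorem id_conv_antipodeInv_conv (g : Module.End k (EHopf k n)) (h : EHopf k n) :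
    LinearMap.mul' k _ (TensorProduct.comm k _ _ (TensorProduct.map (LinearMap.mul' k _ ∘ₗ
      (TensorProduct.comm k _ _).toLinearMap ∘ₗ TensorProduct.map g (antipodeInv k n) ∘ₗ
        Coalgebra.comul) LinearMap.id (Coalgebra.comul h))) = g h := by
  have h1 : ∀ t : EHopf k n ⊗[k] EHopf k n,
      LinearMap.mul' k _ (TensorProduct.comm k _ _ (TensorProduct.map (LinearMap.mul' k _ ∘ₗ
        (TensorProduct.comm k _ _).toLinearMap ∘ₗ TensorProduct.map g (antipodeInv k n) ∘ₗ
          Coalgebra.comul) LinearMap.id t)) =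
      LinearMap.mul' k _ (TensorProduct.comm k _ _ (TensorProduct.map g (LinearMap.mul' k _ ∘ₗ
        TensorProduct.map LinearMap.id (antipodeInv k n) ∘ₗ
          (TensorProduct.comm k _ _).toLinearMap) (TensorProduct.assoc k _ _ _
            ((Coalgebra.comul (R := k)).rTensor _ t)))) := by
    intro t
    induction t using TensorProduct.induction_on with
    | zero => simp
    | add s t hs ht => simp only [map_add, hs, ht]
    | tmul u v =>
      simp only [TensorProduct.map_tmul, LinearMap.rTensor_tmul, LinearMap.comp_apply]
      generalize (Coalgebra.comul u : EHopf k n ⊗[k] EHopf k n) = s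
      induction s using TensorProduct.induction_on with
      | zero => simp
      | add s t hs ht =>
        simp only [map_add, TensorProduct.add_tmul] at hs ht ⊢
        simp only [hs, ht]
      | tmul p q => simp [mul_assoc]
  have h2 : ∀ t : EHopf k n ⊗[k] EHopf k n,
      LinearMap.mul' k _ (TensorProduct.comm k _ _ (TensorProduct.map g (LinearMap.mul' k _ ∘ₗ
        TensorProduct.map LinearMap.id (antipodeInv k n) ∘ₗ
          (TensorProduct.comm k _ _).toLinearMap) ((Coalgebra.comul (R := k)).lTensor _ t))) =
        g (TensorProduct.rid k _ ((Coalgebra.counit (R := k)).lTensor _ t)) := by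
    intro t
    induction t using TensorProduct.induction_on with
    | zero => simp
    | add s t hs ht => simp only [map_add, hs, ht]
    | tmul u v =>
      simp only [LinearMap.lTensor_tmul, TensorProduct.map_tmul, LinearMap.comp_apply,
        LinearEquiv.coe_coe, antipodeInv_right]
      simp [Algebra.algebraMap_eq_smul_one]
  rw [h1, Coalgebra.coassoc_apply, h2, Coalgebra.lTensor_counit_comul]
  simp

/-- `∑ f(h₁) h₂ S(h₃) = f(h)`. -/
theorem hitLeft_conv_antipode (f : EHopf k n →ₗ[k] k) (h : EHopf k n) :
    LinearMap.mul' k _ (TensorProduct.map (hitLeft f) (antipodeLin k n) (Coalgebra.comul h)) =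
      f h • 1 := by
  have h1 : ∀ t : EHopf k n ⊗[k] EHopf k n,
      LinearMap.mul' k _ (TensorProduct.map (hitLeft f) (antipodeLin k n) t) =
      TensorProduct.lid k _ (TensorProduct.map f (LinearMap.mul' k _ ∘ₗ
        (antipodeLin k n).lTensor _) (TensorProduct.assoc k _ _ _
          ((Coalgebra.comul (R := k)).rTensor _ t))) := by
    intro t
    induction t using TensorProduct.induction_on with
    | zero => simp
    | add s t hs ht => simp only [map_add, hs, ht]
    | tmul u v =>
      simp only [TensorProduct.map_tmul, LinearMap.rTensor_tmul, hitLeft_apply]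
      generalize (Coalgebra.comul u : EHopf k n ⊗[k] EHopf k n) = s
      induction s using TensorProduct.induction_on with
      | zero => simp
      | add s t hs ht => simp only [map_add, TensorProduct.add_tmul, hs, ht]
      | tmul p q => simp
  have h2 : ∀ t : EHopf k n ⊗[k] EHopf k n,
      TensorProduct.lid k _ (TensorProduct.map f (LinearMap.mul' k _ ∘ₗ
        (antipodeLin k n).lTensor _) ((Coalgebra.comul (R := k)).lTensor _ t)) =
        f (TensorProduct.rid k _ ((Coalgebra.counit (R := k)).lTensor _ t)) • 1 := by
    intro t
    induction t using TensorProduct.induction_on with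
    | zero => simp
    | add s t hs ht => simp only [map_add, hs, ht, add_smul]
    | tmul u v =>
      simp [antipode_right, Algebra.algebraMap_eq_smul_one, smul_smul, mul_comm]
  rw [h1, Coalgebra.coassoc_apply, h2, Coalgebra.lTensor_counit_comul]
  simp

/-- `∑ S⁻¹(h₃) h₂ r(h₁ ⊗ d₁) d₂ = r(h ⊗ d₁) d₂`. -/
theorem antipodeInv_conv_leftTwist (A : Matrix (Fin n) (Fin n) k) (h d : EHopf k n) :
    LinearMap.mul' k _ (TensorProduct.comm k _ _ (TensorProduct.map
      ((leftTwist A).flip d ∘ₗ Coalgebra.comul) (antipodeInv k n) (Coalgebra.comul h))) =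
      act A h d := by
  have h1 : ∀ t : EHopf k n ⊗[k] EHopf k n,
      LinearMap.mul' k _ (TensorProduct.comm k _ _ (TensorProduct.map
        ((leftTwist A).flip d ∘ₗ Coalgebra.comul) (antipodeInv k n) t)) =
      LinearMap.mul' k _ (TensorProduct.comm k _ _ (TensorProduct.map ((act A).flip d)
        (LinearMap.mul' k _ ∘ₗ TensorProduct.map (antipodeInv k n) LinearMap.id ∘ₗ
          (TensorProduct.comm k _ _).toLinearMap) (TensorProduct.assoc k _ _ _
            ((Coalgebra.comul (R := k)).rTensor _ t)))) := by
    intro t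
    induction t using TensorProduct.induction_on with
    | zero => simp
    | add s t hs ht => simp only [map_add, hs, ht]
    | tmul u v =>
      simp only [TensorProduct.map_tmul, LinearMap.rTensor_tmul, LinearMap.comp_apply]
      generalize (Coalgebra.comul u : EHopf k n ⊗[k] EHopf k n) = s
      induction s using TensorProduct.induction_on with
      | zero => simp
      | add s t hs ht => simp only [map_add, TensorProduct.add_tmul, hs, ht]
      | tmul p q => simp [leftTwist_tmul, mul_assoc]
  have h2 : ∀ t : EHopf k n ⊗[k] EHopf k n,
      LinearMap.mul' k _ (TensorProduct.comm k _ _ (TensorProduct.map ((act A).flip d)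
        (LinearMap.mul' k _ ∘ₗ TensorProduct.map (antipodeInv k n) LinearMap.id ∘ₗ
          (TensorProduct.comm k _ _).toLinearMap) ((Coalgebra.comul (R := k)).lTensor _ t))) =
        act A (TensorProduct.rid k _ ((Coalgebra.counit (R := k)).lTensor _ t)) d := by
    intro t
    induction t using TensorProduct.induction_on with
    | zero => simp
    | add s t hs ht => simp only [map_add, hs, ht, LinearMap.add_apply]
    | tmul u v =>
      simp only [LinearMap.lTensor_tmul, TensorProduct.map_tmul, LinearMap.comp_apply,
        LinearEquiv.coe_coe, antipodeInv_left]
      simp [Algebra.algebraMap_eq_smul_one]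
  rw [h1, Coalgebra.coassoc_apply, h2, Coalgebra.lTensor_counit_comul]
  simp

-- Surjectivity of the pairing supplies every form as r(a ⊗ -); `conv_antipode_conv_id` then reaches
-- an arbitrary endomorphism.
open MulOpposite in
theorem azumayaG_surjective (A : Matrix (Fin n) (Fin n) k)
    (hA : Function.Surjective (pairing A)) :
    Function.Surjective (azumayaG (TensorProduct.lift (pairing A))
      (opComoduleAlgebra k (EHopf k n))) := by
  set G := azumayaG (TensorProduct.lift (pairing A)) (opComoduleAlgebra k (EHopf k n)) with hG
  -- The preimage is ∑ a₁ ⊗ bS⁻¹(a₂), since ∑ bS⁻¹(a₃)a₂r(a₁ ⊗ d₁)d₂ = ∑ b r(a ⊗ d₁)d₂.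
  have h1 : ∀ a b : EHopf k n, ∃ z, ∀ d, G z (op d) = op (b * act A a d) := by
    intro a b
    refine ⟨TensorProduct.map (opLinearEquiv k).toLinearMap ((opLinearEquiv k).toLinearMap ∘ₗ
      LinearMap.mulLeft k b ∘ₗ antipodeInv k n) (Coalgebra.comul a), fun d => ?_⟩
    rw [← antipodeInv_conv_leftTwist]
    generalize (Coalgebra.comul a : EHopf k n ⊗[k] EHopf k n) = t
    induction t using TensorProduct.induction_on with
    | zero => simp
    | add s t hs ht => simp only [map_add, LinearMap.add_apply, hs, ht, mul_add, op_add]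
    | tmul u v =>
      exact (azumayaG_op A u (b * antipodeInv k n v) d).trans (by simp [mul_assoc])
  -- In finite dimension the tensors f ⊗ b span all endomorphisms φ, so every d ↦ ∑ φ(d₁)d₂ is in
  -- the image.
  have h2 : ∀ t : Module.Dual k (EHopf k n) ⊗[k] EHopf k n, ∃ z, ∀ d, G z (op d) =
      op (LinearMap.mul' k _ (TensorProduct.map (dualTensorHom k _ _ t) LinearMap.id
        (Coalgebra.comul d))) := by
    intro t
    induction t using TensorProduct.induction_on with
    | zero => exact ⟨0, by simp⟩
    | add s t hs ht =>
      obtain ⟨z, hz⟩ := hs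
      obtain ⟨w, hw⟩ := ht
      exact ⟨z + w, fun d => by
        simp only [map_add, LinearMap.add_apply, hz, hw, TensorProduct.map_add_left, op_add]⟩
    | tmul f b =>
      obtain ⟨a, rfl⟩ := hA f
      obtain ⟨z, hz⟩ := h1 a b
      refine ⟨z, fun d => ?_⟩
      rw [hz, act_eq_hitLeft, hitLeft_apply]
      congr 1
      generalize (Coalgebra.comul d : EHopf k n ⊗[k] EHopf k n) = s
      induction s using TensorProduct.induction_on with
      | zero => simp
      | add s t hs ht => simp only [map_add, mul_add, hs, ht]
      | tmul u v => simp [dualTensorHom_apply]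
  intro g
  set g' : Module.End k (EHopf k n) := (opLinearEquiv k).symm.toLinearMap ∘ₗ g ∘ₗ
    (opLinearEquiv k).toLinearMap with hg'
  -- The choice φ(d) = ∑ g'(d₁)S(d₂) makes ∑ φ(d₁)d₂ = g'(d).
  obtain ⟨t, ht⟩ := (dualTensorHomEquiv k (EHopf k n) (EHopf k n)).surjective
    (LinearMap.mul' k _ ∘ₗ TensorProduct.map g' (antipodeLin k n) ∘ₗ Coalgebra.comul)
  change dualTensorHom k _ _ t = _ at ht
  obtain ⟨z, hz⟩ := h2 t
  refine ⟨z, LinearMap.ext fun d => ?_⟩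
  obtain ⟨d, rfl⟩ := op_surjective d
  rw [hz, ht, conv_antipode_conv_id]
  simp [hg']

-- The mirror argument for F: here the second argument of r must represent every form, hence the
-- flipped pairing, and S and S⁻¹ exchange roles.
open MulOpposite in
theorem azumayaF_surjective (A : Matrix (Fin n) (Fin n) k)
    (hA : Function.Surjective (pairing A).flip) :
    Function.Surjective (azumayaF (TensorProduct.lift (pairing A))
      (opComoduleAlgebra k (EHopf k n))) := by
  set F := azumayaF (TensorProduct.lift (pairing A)) (opComoduleAlgebra k (EHopf k n)) with hF
  have h0 : ∀ t b : EHopf k n ⊗[k] EHopf k n, ∀ a d, t = Coalgebra.comul d →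
      F (TensorProduct.comm k _ _ (TensorProduct.map (opLinearEquiv k).toLinearMap
        ((opLinearEquiv k).toLinearMap ∘ₗ LinearMap.mulRight k a ∘ₗ antipodeLin k n) b)) (op d) =
      op (LinearMap.mul' k _ (TensorProduct.map (leftTwist A t) (antipodeLin k n) b) * a) := by
    rintro t b a d rfl
    induction b using TensorProduct.induction_on with
    | zero => simp
    | add s t hs ht => simp only [map_add, LinearMap.add_apply, hs, ht, add_mul, op_add]
    | tmul u v =>
      exact (azumayaF_op A (antipodeLin k n v * a) u d).trans (by simp [mul_assoc])
  -- The preimage is ∑ S(b₂)a ⊗ b₁, since ∑ r(d₁ ⊗ b₁)d₂b₂S(b₃)a = ∑ r(d₁ ⊗ b)d₂a.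
  have h1 : ∀ a b : EHopf k n, ∃ z, ∀ d,
      F z (op d) = op (hitLeft ((pairing A).flip b) d * a) := by
    intro a b
    refine ⟨_, fun d => (h0 _ (Coalgebra.comul b) a d rfl).trans ?_⟩
    rw [hitLeft_apply]
    congr 2
    generalize (Coalgebra.comul d : EHopf k n ⊗[k] EHopf k n) = t
    induction t using TensorProduct.induction_on with
    | zero => simp
    | add s t hs ht => simp only [map_add, TensorProduct.map_add_left, LinearMap.add_apply, hs, ht]
    | tmul u v =>
      have h3 : ∀ s : EHopf k n ⊗[k] EHopf k n,
          LinearMap.mul' k _ (TensorProduct.map (leftTwist A (u ⊗ₜ v)) (antipodeLin k n) s) =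
          v * LinearMap.mul' k _ (TensorProduct.map (act A u) (antipodeLin k n) s) := by
        intro s
        induction s using TensorProduct.induction_on with
        | zero => simp
        | add s t hs ht => simp only [map_add, mul_add, hs, ht]
        | tmul p q => simp [leftTwist_tmul, mul_assoc]
      rw [h3, act_eq_hitLeft, hitLeft_conv_antipode]
      simp
  have h2 : ∀ t : Module.Dual k (EHopf k n) ⊗[k] EHopf k n, ∃ z, ∀ d, F z (op d) =
      op (LinearMap.mul' k _ (TensorProduct.comm k _ _ (TensorProduct.map
        (dualTensorHom k _ _ t) LinearMap.id (Coalgebra.comul d)))) := by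
    intro t
    induction t using TensorProduct.induction_on with
    | zero => exact ⟨0, by simp⟩
    | add s t hs ht =>
      obtain ⟨z, hz⟩ := hs
      obtain ⟨w, hw⟩ := ht
      exact ⟨z + w, fun d => by
        simp only [map_add, LinearMap.add_apply, hz, hw, TensorProduct.map_add_left, op_add]⟩
    | tmul f a =>
      obtain ⟨b, rfl⟩ := hA f
      obtain ⟨z, hz⟩ := h1 a b
      refine ⟨z, fun d => ?_⟩
      rw [hz, hitLeft_apply]
      congr 1
      generalize (Coalgebra.comul d : EHopf k n ⊗[k] EHopf k n) = s
      induction s using TensorProduct.induction_on with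
      | zero => simp
      | add s t hs ht => simp only [map_add, add_mul, hs, ht]
      | tmul u v => simp [dualTensorHom_apply]
  intro g
  set g' : Module.End k (EHopf k n) := (opLinearEquiv k).symm.toLinearMap ∘ₗ g ∘ₗ
    (opLinearEquiv k).toLinearMap with hg'
  -- The choice φ(d) = ∑ S⁻¹(d₂)g'(d₁) makes ∑ d₂φ(d₁) = g'(d).
  obtain ⟨t, ht⟩ := (dualTensorHomEquiv k (EHopf k n) (EHopf k n)).surjective
    (LinearMap.mul' k _ ∘ₗ (TensorProduct.comm k _ _).toLinearMap ∘ₗ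
      TensorProduct.map g' (antipodeInv k n) ∘ₗ Coalgebra.comul)
  change dualTensorHom k _ _ t = _ at ht
  obtain ⟨z, hz⟩ := h2 t
  refine ⟨z, LinearMap.ext fun d => ?_⟩
  obtain ⟨d, rfl⟩ := op_surjective d
  rw [hz, ht, id_conv_antipodeInv_conv]
  simp [hg']

end EHopf

end

/-! ### The Azumaya criterion -/

theorem corollary3p2 {k : Type*} [Field k] (hk : ringChar k ≠ 2) {n : ℕ} (hn : 1 ≤ n)
    (A : Matrix (Fin n) (Fin n) k) :
    IsUniversalRForm k (EHopf.rForm A) ∧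
      (IsHAzumaya (EHopf.rForm A) (opComoduleAlgebra k (EHopf k n)) ↔ A.det ≠ 0) := by
  rw [EHopf.rForm_eq]
  refine ⟨EHopf.pairing_isUniversalRForm A,
    fun h => EHopf.det_ne_zero_of_injective A h.2.2.1, fun hA => ?_⟩
  have hinj := EHopf.pairing_injective hk A hA
  have hsurj : Function.Surjective (EHopf.pairing A) :=
    (LinearMap.injective_iff_surjective_of_finrank_eq_finrank (by simp)).1 hinj
  have hfin : Module.Finite k (EHopf k n)ᵐᵒᵖ :=
    Module.Finite.equiv (MulOpposite.opLinearEquiv k)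
  -- Both sides have dimension (dim E(n))², so surjectivity of F and G suffices.
  have hrank : Module.finrank k ((EHopf k n)ᵐᵒᵖ ⊗[k] (EHopf k n)ᵐᵒᵖ) =
      Module.finrank k (Module.End k (EHopf k n)ᵐᵒᵖ) := by
    simp [Module.finrank_linearMap]
  have hF := EHopf.azumayaF_surjective A (LinearMap.flip_surjective_iff₁.2 hinj)
  have hG := EHopf.azumayaG_surjective A hsurj
  exact ⟨hfin, ⟨(LinearMap.injective_iff_surjective_of_finrank_eq_finrank hrank).2 hF, hF⟩,
    ⟨(LinearMap.injective_iff_surjective_of_finrank_eq_finrank hrank).2 hG, hG⟩⟩
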